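/- Let $n\ge 1$ agents minimize $f=\sum_{i=1}^n f_i$ over $\mathbb{R}^d$, where $f_i(x)=\mathbb{E}_{\xi\sim\mathcal{D}_i}[\ell_i(x,\xi)]$ is differentiable with $L_i$-Lipschitz gradient and is $\mu$-strongly convex, $\mu>0$: $\langle\nabla f_i(x)-\nabla f_i(y),x-y\rangle\ge\mu\|x-y\|^2$. The agents have stochastic gradients $g_i$ with $\mathbb{E}_{\xi\sim\mathcal{D}_i}[g_i(x,\xi)]=\nabla f_i(x)$ and $\mathbb{E}_{\xi\sim\mathcal{D}_i}\|g_i(x,\xi)-\nabla f_i(x)\|^2\le\sigma_g^2$ for all $x$ and $i$. Let $A=(a_{ij})$ be a doubly stochastic matrix whose entries are positive for $j=i$ and for neighbours $j$ of $i$ in a connected undirected graph on the agents, and zero otherwise. Let $\alpha_k=\frac{a_1}{(k+a_2)^{\alpha}}$, $\beta_k=\frac{a_1}{(k+a_2)^{\beta}}$, $\gamma_k=\lceil a_3(k+a_2)^{\gamma}\rceil$ and $\sigma_k=b(k+a_2)^{\eta}$ for $k\ge 0$, with $a_1,a_2,a_3,b>0$, $\gamma+\eta>1$, $0<\beta<\alpha\le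 1$, $\gamma\ge 0$ and $0\le\eta\le\min\{\frac{\beta}{2},\frac{\alpha-\beta}{2}\}$. From arbitrary initial values $x_{i,0}\in\mathbb{R}^d$, the algorithm computes $$x_{i,k+1}=(1-\beta_k)x_{i,k}+\beta_k\sum_{j=1}^n a_{ij}x_{j,k}-\alpha_k\,(g_i^k+n_{i,k}),\qquad g_i^k=\frac1{\gamma_k}\sum_{l=1}^{\gamma_k}g_i(x_{i,k},\xi_{i,k}^l).$$ Here the samples $\xi_{i,k}^l$ have law $\mathcal{D}_i$, are independent over $l$ for each $i$ and $k$, and the collections $(\xi_{i,k}^l)_{i,l}$ are independent over $k$; all coordinates of all noises $n_{i,k}\in\mathbb{R}^d$ are independent of each other, Laplace distributed with mean $0$ and variance $2\sigma_k^2$, and the noises are independent of the samples. Then the following hold simultaneously. (1) (Mean-square convergence.) There is a minimizer $x^*$ of $f$ such that $\mathbb{E}\|x_{i,k}-x^*\|^2$ is finite for all $i,k$ and $\lim_{k\to\infty}\mathbb{E}\|x_{i,k}-x^*\|^2=0$ for every $i$. (2) (Differential privacy with a finite cumulative budget over infinitely many iterations.) Let $C>0$. Call two collections of samples for iteration $k$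 adjacent at the network state $x=(x_1,\dots,x_n)$ if their sampled gradients $g_i(x_i,\cdot)$ (agents $i$, indices $l\le\gamma_k$) agree except for at most one index of one agent, where they differ by at most $C$ in $\ell^1$ norm. Then $\varepsilon=\sum_{k=0}^{\infty}\frac{C}{\gamma_k\sigma_k}$ is finite. For each $k$ and each network state $x$, releasing the perturbed gradients $(g_i^k+n_{i,k})_i$ is $\frac{C}{\gamma_k\sigma_k}$-differentially private for samples adjacent at $x$. The entire infinite run, in which the states and the perturbed gradients of all agents are released at every iteration, is $\varepsilon$-differentially private: if $\mathbf{D}$ and $\mathbf{D}'$ prescribe the samples used in each iteration (possibly as measurable functions of the current network state) and are adjacent in every iteration at every state, then the released sequences $\mathcal{A}(\mathbf{D})$ and $\mathcal{A}(\mathbf{D}')$ satisfy $\mathbb{P}\{\mathcal{A}(\mathbf{D})\in\Upsilon\}\le e^{\varepsilon}\,\mathbb{P}\{\mathcal{A}(\mathbf{D}')\in\Upsilon\}$ for every measurable set $\Upsilon$, where the probability is that of the noises. -/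

import Mathlib

open MeasureTheory ProbabilityTheory Filter Topology

noncomputable section

/-- The decision space `ℝᵈ` with the Euclidean norm. -/
abbrev Vec (d : ℕ) : Type := EuclideanSpace ℝ (Fin d)

/-- The `ℓ¹` norm of a vector. -/
def l1Norm {d : ℕ} (v : Vec d) : ℝ := ∑ j, |v j|

/-- The zero-mean Laplace law with scale `b > 0` (variance `2 b ^ 2`). -/
def laplaceMeasure (b : ℝ) : Measure ℝ :=
  volume.withDensity fun t => ENNReal.ofReal ((2 * b)⁻¹ * Real.exp (-|t| / b))

/-- The expected cost `f(x) = E_{z ∼ 𝒟}[ℓ(x, z)]`. -/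
def expectedCost {d : ℕ} {Ξ : Type*} [MeasurableSpace Ξ] (ℓ : Vec d → Ξ → ℝ) (𝒟 : Measure Ξ)
    (x : Vec d) : ℝ :=
  ∫ z, ℓ x z ∂𝒟

/-- `f` is differentiable, its gradient is `L`-Lipschitz, and `f` is `μ`-strongly convex. -/
structure SmoothStronglyConvex {d : ℕ} (f : Vec d → ℝ) (L μ : ℝ) : Prop where
  differentiable : Differentiable ℝ f
  lipschitz : ∀ x y, ‖gradient f x - gradient f y‖ ≤ L * ‖x - y‖
  stronglyConvex : ∀ x y, μ * ‖x - y‖ ^ 2 ≤ inner ℝ (gradient f x - gradient f y) (x - y)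

/-- `g` is an unbiased stochastic gradient of `f` for samples of law `𝒟`, with variance at most
`s ^ 2` at every point. -/
structure UnbiasedGradient {d : ℕ} {Ξ : Type*} [MeasurableSpace Ξ] (f : Vec d → ℝ)
    (g : Vec d → Ξ → Vec d) (𝒟 : Measure Ξ) (s : ℝ) : Prop where
  measurable : Measurable (Function.uncurry g)
  memLp : ∀ x, MemLp (g x) 2 𝒟
  unbiased : ∀ x, ∫ z, g x z ∂𝒟 = gradient f x
  variance_le : ∀ x, ∫ z, ‖g x z - gradient f x‖ ^ 2 ∂𝒟 ≤ s ^ 2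

/-- `A` is a weight matrix of the connected undirected network `G`: it is doubly stochastic, its
entries are bounded below by a positive constant on neighbourhoods (every agent being its own
neighbour), and they vanish elsewhere. -/
structure NetworkWeights {n : ℕ} (G : SimpleGraph (Fin n)) (A : Matrix (Fin n) (Fin n) ℝ) :
    Prop where
  connected : G.Connected
  pos : ∃ c : ℝ, 0 < c ∧ ∀ i j, (i = j ∨ G.Adj i j) → c < A i j
  zero : ∀ i j, ¬ (i = j ∨ G.Adj i j) → A i j = 0
  row_sum : ∀ i, ∑ j, A i j = 1
  col_sum : ∀ j, ∑ i, A i j = 1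

/-- The average of `N` sampled gradients at `x`. -/
def batchGradient {d : ℕ} {Ξ : Type*} (g : Vec d → Ξ → Vec d) (N : ℕ) (x : Vec d) (z : ℕ → Ξ) :
    Vec d :=
  (N : ℝ)⁻¹ • ∑ l ∈ Finset.range N, g x (z l)

/-- The perturbed batch gradients of all agents in one iteration: `x` is the state of the
network, `z i l` the `l`-th sample of agent `i`, and `ν i` the noise of agent `i`. -/
def noisyGradients {n d : ℕ} {Ξ : Type*} (g : Fin n → Vec d → Ξ → Vec d) (N : ℕ)
    (x : Fin n → Vec d) (z : Fin n → ℕ → Ξ) (ν : Fin n → Vec d) : Fin n → Vec d :=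
  fun i => batchGradient (g i) N (x i) (z i) + ν i

/-- The states of the gradient-perturbation algorithm
`x_{i,k+1} = (1 - β_k) x_{i,k} + β_k ∑_j a_{ij} x_{j,k} - α_k (g_i^k + n_{i,k})`.
`z k x i l` is the `l`-th sample that agent `i` uses in iteration `k` if the network is then in
state `x`; for an ordinary stream of samples it does not depend on `x`. -/
def algState {n d : ℕ} {Ξ : Type*} (A : Matrix (Fin n) (Fin n) ℝ) (α β : ℕ → ℝ) (γ : ℕ → ℕ)
    (g : Fin n → Vec d → Ξ → Vec d) (x₀ : Fin n → Vec d)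
    (z : ℕ → (Fin n → Vec d) → Fin n → ℕ → Ξ) (ν : ℕ → Fin n → Vec d) : ℕ → Fin n → Vec d
  | 0 => x₀
  | k + 1 => fun i =>
      (1 - β k) • algState A α β γ g x₀ z ν k i
        + β k • ∑ j, A i j • algState A α β γ g x₀ z ν k j
        - α k • noisyGradients g (γ k) (algState A α β γ g x₀ z ν k)
            (z k (algState A α β γ g x₀ z ν k)) (ν k) i

/-- All that the algorithm releases in an infinite run: in every iteration, the states and the
perturbed gradients of all agents. -/
def algTranscript {n d : ℕ} {Ξ : Type*} (A : Matrix (Fin n) (Fin n) ℝ) (α β : ℕ → ℝ) (γ : ℕ → ℕ)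
    (g : Fin n → Vec d → Ξ → Vec d) (x₀ : Fin n → Vec d)
    (z : ℕ → (Fin n → Vec d) → Fin n → ℕ → Ξ) (ν : ℕ → Fin n → Vec d) :
    ℕ → (Fin n → Vec d) × (Fin n → Vec d) :=
  fun k =>
    (algState A α β γ g x₀ z ν k,
      noisyGradients g (γ k) (algState A α β γ g x₀ z ν k)
        (z k (algState A α β γ g x₀ z ν k)) (ν k))

/-- The samples `ξ k i l` (iteration `k`, agent `i`, index `l`): those of agent `i` have law `𝒟 i`,
the samples of one agent in one iteration are independent, and so are the collections of all
samples of the different iterations. -/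
structure SampleProcess {n : ℕ} {Ξ Ω : Type*} [MeasurableSpace Ξ] [MeasurableSpace Ω]
    (P : Measure Ω) (𝒟 : Fin n → Measure Ξ) (ξ : ℕ → Fin n → ℕ → Ω → Ξ) : Prop where
  measurable : ∀ k i l, Measurable (ξ k i l)
  law : ∀ k i l, P.map (ξ k i l) = 𝒟 i
  indep_batch : ∀ k i, iIndepFun (ξ k i) P
  indep_iterations : iIndepFun (fun k ω => fun i l => ξ k i l ω) P

/-- Privacy noises: all coordinates of all the vectors `ν k i` are independent, and those of
iteration `k` have the Laplace law with scale `σ k`. -/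
structure LaplaceNoise {n d : ℕ} {Ω : Type*} [MeasurableSpace Ω] (P : Measure Ω) (σ : ℕ → ℝ)
    (ν : ℕ → Fin n → Ω → Vec d) : Prop where
  measurable : ∀ k i, Measurable (ν k i)
  law : ∀ k i j, P.map (fun ω => ν k i ω j) = laplaceMeasure (σ k)
  indep : iIndepFun (fun (p : ℕ × Fin n × Fin d) ω => ν p.1 p.2.1 ω p.2.2) P

/-- `ε`-differential privacy of the mechanism `M` with respect to the adjacency relation `adj`;
the randomness of `M` is that of `ω ∼ P`. -/
def DifferentiallyPrivate {Dat Out Ω : Type*} [MeasurableSpace Out] [MeasurableSpace Ω]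
    (P : Measure Ω) (adj : Dat → Dat → Prop) (M : Dat → Ω → Out) (ε : ℝ) : Prop :=
  ∀ D D', adj D D' → ∀ Υ : Set Out, MeasurableSet Υ →
    P {ω | M D ω ∈ Υ} ≤ ENNReal.ofReal (Real.exp ε) * P {ω | M D' ω ∈ Υ}

/-- Two batches of `N` sampled gradients agree but for at most one, and there they are at
`ℓ¹`-distance at most `C`. -/
def AdjacentBatches {d : ℕ} (C : ℝ) (N : ℕ) (D D' : ℕ → Vec d) : Prop :=
  ∃ l₀ < N, (∀ l < N, l ≠ l₀ → D l = D' l) ∧ l1Norm (D l₀ - D' l₀) ≤ C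

/-- Adjacency of the samples of one iteration, at the network state `x`: the batches of sampled
gradients of one agent are adjacent, those of the other agents are equal. -/
def AdjacentSamples {n d : ℕ} {Ξ : Type*} (g : Fin n → Vec d → Ξ → Vec d) (C : ℝ) (N : ℕ)
    (x : Fin n → Vec d) (z z' : Fin n → ℕ → Ξ) : Prop :=
  ∃ i, AdjacentBatches C N (fun l => g i (x i) (z i l)) (fun l => g i (x i) (z' i l)) ∧
    ∀ j, j ≠ i → ∀ l < N, g j (x j) (z j l) = g j (x j) (z' j l)

/-- The data of an infinite run: `z k x i l` is the `l`-th sample of agent `i` in iteration `k`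
if the network is then in state `x`. Fixed streams of samples are the case of no dependence
on `x`; the dependence allows the data to be chosen adaptively, as adjacency refers to the
gradients at the current state. -/
structure DataStream (n d : ℕ) (Ξ : Type*) [MeasurableSpace Ξ] where
  z : ℕ → (Fin n → Vec d) → Fin n → ℕ → Ξ
  measurable : ∀ k i l, Measurable fun x => z k x i l

/-- Adjacency of the data of an infinite run: adjacency in every iteration, at every state. -/
def AdjacentStreams {n d : ℕ} {Ξ : Type*} [MeasurableSpace Ξ] (g : Fin n → Vec d → Ξ → Vec d)
    (C : ℝ) (γ : ℕ → ℕ) (D D' : DataStream n d Ξ) : Prop :=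
  ∀ k x, AdjacentSamples g C (γ k) x (D.z k x) (D'.z k x)

end

noncomputable section

open scoped ENNReal symmDiff

/-! Privacy. The density of a Laplace law of scale `σ` changes under translation by `v` at most by
the factor `exp (|v| / σ)`, so independent coordinates give `exp (‖v‖₁ / σ)` for vectors. Adjacent
samples move the batch gradient of a single agent by at most `C / γ k` in `ℓ¹`, whence the cost `C /
(γ k * σ k)` of one iteration. The released state is a function of what was released before, so with
the past frozen each iteration is the one-step mechanism at a known state, and the factors multiply
(`lintegral_truncate_algTranscript_le`). The bound for finite prefixes is uniform, by the sum of the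
series, and approximation by cylinder sets carries it to the infinite run
(`le_smul_of_forall_truncate`). The series converges by comparison with the exponent `γ + η > 1`.

Convergence. Let `p` be the zero of the sum of the gradients and `V k` the sum over the agents of
the mean squared distances to `p`. Strong convexity contracts `V` by `1 - α k * μ`. The single
gradients at `p` need not vanish, but they sum to zero, so their drift only pairs with differences
between agents. A Poincaré inequality on the connected network bounds these by the disagreement,
which the consensus term decreases at rate `β k`; the price is of order `α k ^ 2 / β k`
(`exists_sum_norm_step_sq_le`). The sampling error and the privacy noise are centred given the past,
so they enter only through second moments, with factor `α k ^ 2` (`runState_succ_mean_square`). All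
perturbations are `o (α k)` because `α / β → 0`, `α → 0` and `α * σ ^ 2 → 0`; since `∑ α` diverges,
`V → 0` (`tendsto_zero_of_le_one_sub_mul_add`). -/

/-! ### Translated Laplace noise and the privacy of one iteration. -/

/-- Product measures are monotone in their factors, up to constants. -/
theorem MeasureTheory.Measure.pi_le_smul_pi {ι : Type*} [Fintype ι] {X : ι → Type*}
    [∀ i, MeasurableSpace (X i)] (μ ν : ∀ i, Measure (X i)) [∀ i, IsFiniteMeasure (μ i)]
    [∀ i, IsFiniteMeasure (ν i)] (c : ι → ℝ≥0∞) (h : ∀ i, μ i ≤ c i • ν i)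
    (hc : ∀ i, c i ≠ ∞) :
    Measure.pi μ ≤ (∏ i, c i) • Measure.pi ν := by
  have hfin : ∀ i, IsFiniteMeasure (c i • ν i) := fun i => Measure.smul_finite _ (hc i)
  have hpi : Measure.pi (fun i => c i • ν i) = (∏ i, c i) • Measure.pi ν := by
    refine Measure.pi_eq fun s _ => ?_
    simp [Measure.pi_pi, Finset.prod_mul_distrib]
  rw [← hpi]
  refine Measure.le_iff.2 fun s hs => ?_
  -- `OuterMeasure.pi` is the largest outer measure bounded on boxes by the product of the factors,
  -- so only boxes need to be compared.
  have hle : (Measure.pi μ).toOuterMeasure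
      ≤ OuterMeasure.pi fun i => (c i • ν i).toOuterMeasure := by
    refine OuterMeasure.le_pi.2 fun t _ => ?_
    change Measure.pi μ (Set.univ.pi t) ≤ _
    rw [Measure.pi_pi]
    exact Finset.prod_le_prod' fun i _ => h i (t i)
  refine (hle s).trans ?_
  rw [Measure.pi]
  exact (toMeasure_apply _ _ hs).ge

theorem measurable_laplaceDensity (b : ℝ) :
    Measurable fun t : ℝ => ENNReal.ofReal ((2 * b)⁻¹ * Real.exp (-|t| / b)) := by
  fun_prop

/-- Translating a Laplace law changes it at most by the factor `exp (|v| / b)`. -/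
theorem laplaceMeasure_map_add_le {b : ℝ} (hb : 0 < b) (v : ℝ) :
    (laplaceMeasure b).map (fun t => v + t)
      ≤ ENNReal.ofReal (Real.exp (|v| / b)) • laplaceMeasure b := by
  refine Measure.le_iff.2 fun s hs => ?_
  have hm : Measurable fun t : ℝ => v + t := measurable_const_add v
  rw [Measure.map_apply hm hs, Measure.smul_apply, laplaceMeasure,
    withDensity_apply _ (hm hs), withDensity_apply _ hs, smul_eq_mul,
    ← lintegral_const_mul _ (measurable_laplaceDensity b), ← lintegral_indicator (hm hs),
    ← lintegral_indicator hs]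
  -- Translation invariance of Lebesgue measure brings both densities to the same variable `t`;
  -- there the triangle inequality compares them pointwise.
  rw [← lintegral_add_left_eq_self (μ := (volume : Measure ℝ)) (g := v)
    (f := s.indicator fun a => ENNReal.ofReal (Real.exp (|v| / b))
      * ENNReal.ofReal ((2 * b)⁻¹ * Real.exp (-|a| / b)))]
  refine lintegral_mono fun t => ?_
  by_cases ht : v + t ∈ s
  · have ht' : t ∈ (fun t => v + t) ⁻¹' s := ht
    rw [Set.indicator_of_mem ht, Set.indicator_of_mem ht',
      ← ENNReal.ofReal_mul (Real.exp_pos _).le]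
    refine ENNReal.ofReal_le_ofReal ?_
    rw [mul_left_comm, ← Real.exp_add]
    gcongr
    rw [← add_div]
    gcongr
    have := abs_add_le v t
    linarith
  · have ht' : t ∉ (fun t => v + t) ⁻¹' s := ht
    rw [Set.indicator_of_notMem ht']
    exact zero_le

/-- Translating the noises of one iteration changes expectations at most by the exponential of
the `ℓ¹` norm of the translation over the scale. -/
theorem LaplaceNoise.lintegral_add_le {n d : ℕ} {Ω : Type*} [MeasurableSpace Ω]
    {P : Measure Ω} [IsProbabilityMeasure P] {σ : ℕ → ℝ} {ν : ℕ → Fin n → Ω → Vec d}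
    (hν : LaplaceNoise P σ ν) {k : ℕ} (hσ : 0 < σ k) (v : Fin n → Vec d)
    {f : (Fin n → Vec d) → ℝ≥0∞} (hf : Measurable f) :
    ∫⁻ ω, f (v + fun i => ν k i ω) ∂P
      ≤ ENNReal.ofReal (Real.exp ((∑ i, l1Norm (v i)) / σ k))
        * ∫⁻ ω, f (fun i => ν k i ω) ∂P := by
  -- Independence is given coordinatewise, so the noises are flattened to one real vector `F`, whose
  -- law is a product of Laplace laws; `asm` reassembles the vectors of the agents.
  let F : Ω → Fin n × Fin d → ℝ := fun ω p => ν k p.1 ω p.2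
  let w : Fin n × Fin d → ℝ := fun p => v p.1 p.2
  let asm : (Fin n × Fin d → ℝ) → Fin n → Vec d := fun u i => WithLp.toLp 2 fun j => u (i, j)
  have hFp : ∀ p : Fin n × Fin d, Measurable fun ω => ν k p.1 ω p.2 := fun p => by
    have := hν.measurable k p.1
    fun_prop
  have hF : Measurable F := measurable_pi_lambda _ hFp
  have hasm : Measurable asm := by
    refine measurable_pi_lambda _ fun i => ?_
    exact (WithLp.measurable_toLp 2 _).comp (measurable_pi_lambda _ fun j => measurable_pi_apply _)
  have hind : iIndepFun (fun (p : Fin n × Fin d) ω => ν k p.1 ω p.2) P :=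
    hν.indep.precomp (g := fun p : Fin n × Fin d => (k, p.1, p.2)) fun p q h => by
      simpa [Prod.ext_iff] using h
  have hmap : P.map F = Measure.pi fun p : Fin n × Fin d => P.map fun ω => ν k p.1 ω p.2 :=
    (iIndepFun_iff_map_fun_eq_pi_map fun p => (hFp p).aemeasurable).1 hind
  have hprob : ∀ p : Fin n × Fin d, IsProbabilityMeasure (P.map fun ω => ν k p.1 ω p.2) :=
    fun p => Measure.isProbabilityMeasure_map (hFp p).aemeasurable
  have hshift : (P.map F).map (fun u => w + u)
      ≤ ENNReal.ofReal (Real.exp ((∑ i, l1Norm (v i)) / σ k)) • P.map F := by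
    have hprob' : ∀ p : Fin n × Fin d,
        IsProbabilityMeasure ((P.map fun ω => ν k p.1 ω p.2).map fun t => w p + t) :=
      fun p => Measure.isProbabilityMeasure_map (measurable_const_add _).aemeasurable
    have h1 : (P.map F).map (fun u => w + u)
        = Measure.pi fun p => (P.map fun ω => ν k p.1 ω p.2).map fun t => w p + t := by
      rw [hmap, ← Measure.pi_map_pi fun p => (measurable_const_add (w p)).aemeasurable]
      rfl
    have h2 : ENNReal.ofReal (Real.exp ((∑ i, l1Norm (v i)) / σ k))
        = ∏ p, ENNReal.ofReal (Real.exp (|w p| / σ k)) := by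
      rw [← ENNReal.ofReal_prod_of_nonneg fun p _ => (Real.exp_pos _).le, ← Real.exp_sum,
        ← Finset.sum_div, Fintype.sum_prod_type]
      rfl
    rw [h1, h2, hmap]
    refine Measure.pi_le_smul_pi _ _ _ (fun p => ?_) fun p => ENNReal.ofReal_ne_top
    rw [hν.law k p.1 p.2]
    exact laplaceMeasure_map_add_le hσ _
  have hν' : ∀ ω, (fun i => ν k i ω) = asm (F ω) := fun ω => by
    ext i j
    rfl
  have hv : ∀ u, v + asm u = asm (w + u) := fun u => by
    ext i j
    rfl
  simp only [hν', hv]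
  have hfa : Measurable fun u => f (asm u) := hf.comp hasm
  calc ∫⁻ ω, f (asm (w + F ω)) ∂P
      = ∫⁻ u, f (asm u) ∂(P.map F).map (fun u => w + u) := by
        rw [lintegral_map hfa (measurable_const_add w)]
        exact (lintegral_map (f := fun u => f (asm (w + u)))
          (hfa.comp (measurable_const_add w)) hF).symm
    _ ≤ ∫⁻ u, f (asm u) ∂(ENNReal.ofReal (Real.exp ((∑ i, l1Norm (v i)) / σ k)) • P.map F) :=
        lintegral_mono' hshift le_rfl
    _ = _ := by rw [lintegral_smul_measure, smul_eq_mul, lintegral_map hfa hF]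

theorem l1Norm_zero {d : ℕ} : l1Norm (0 : Vec d) = 0 := by simp [l1Norm]

theorem l1Norm_smul {d : ℕ} (c : ℝ) (v : Vec d) : l1Norm (c • v) = |c| * l1Norm v := by
  simp [l1Norm, abs_mul, Finset.mul_sum]

/-- All terms but one cancel, and averaging divides the remaining one by the batch size: larger
batches lower the sensitivity. -/
theorem AdjacentBatches.l1Norm_sub_le {d : ℕ} {C : ℝ} {N : ℕ} {D D' : ℕ → Vec d}
    (h : AdjacentBatches C N D D') :
    l1Norm ((N : ℝ)⁻¹ • ∑ l ∈ Finset.range N, D l - (N : ℝ)⁻¹ • ∑ l ∈ Finset.range N, D' l)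
      ≤ C / N := by
  obtain ⟨l₀, hl₀, heq, hC⟩ := h
  have : ∑ l ∈ Finset.range N, D l - ∑ l ∈ Finset.range N, D' l = D l₀ - D' l₀ := by
    rw [← Finset.sum_sub_distrib]
    refine Finset.sum_eq_single_of_mem l₀ (Finset.mem_range.2 hl₀) fun l hl hne => ?_
    rw [heq l (Finset.mem_range.1 hl) hne, sub_self]
  rw [← smul_sub, this, l1Norm_smul, abs_of_nonneg (by positivity), div_eq_inv_mul]
  gcongr

theorem AdjacentSamples.sum_l1Norm_le {n d : ℕ} {Ξ : Type*} {g : Fin n → Vec d → Ξ → Vec d}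
    {C : ℝ} {N : ℕ} {x : Fin n → Vec d} {z z' : Fin n → ℕ → Ξ}
    (h : AdjacentSamples g C N x z z') :
    ∑ i, l1Norm (batchGradient (g i) N (x i) (z i) - batchGradient (g i) N (x i) (z' i))
      ≤ C / N := by
  obtain ⟨i, hi, hne⟩ := h
  rw [Finset.sum_eq_single_of_mem i (Finset.mem_univ i)]
  · exact hi.l1Norm_sub_le
  · intro j _ hj
    have : batchGradient (g j) N (x j) (z j) = batchGradient (g j) N (x j) (z' j) := by
      unfold batchGradient
      rw [Finset.sum_congr rfl fun l hl => hne j hj l (Finset.mem_range.1 hl)]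
    rw [this, sub_self, l1Norm_zero]

/-- One iteration is private, in terms of expectations of nonnegative functions. -/
theorem LaplaceNoise.lintegral_noisyGradients_le {n d : ℕ} {Ξ Ω : Type*} [MeasurableSpace Ω]
    {P : Measure Ω} [IsProbabilityMeasure P] {σ : ℕ → ℝ} {ν : ℕ → Fin n → Ω → Vec d}
    (hν : LaplaceNoise P σ ν) {k : ℕ} (hσ : 0 < σ k) {g : Fin n → Vec d → Ξ → Vec d}
    {C : ℝ} {N : ℕ} {x : Fin n → Vec d} {z z' : Fin n → ℕ → Ξ}
    (h : AdjacentSamples g C N x z z') {f : (Fin n → Vec d) → ℝ≥0∞} (hf : Measurable f) :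
    ∫⁻ ω, f (noisyGradients g N x z fun i => ν k i ω) ∂P
      ≤ ENNReal.ofReal (Real.exp (C / (N * σ k)))
        * ∫⁻ ω, f (noisyGradients g N x z' fun i => ν k i ω) ∂P := by
  let c : (Fin n → ℕ → Ξ) → Fin n → Vec d := fun z i => batchGradient (g i) N (x i) (z i)
  have hc : ∀ z ω, noisyGradients g N x z (fun i => ν k i ω) = c z + fun i => ν k i ω :=
    fun z ω => rfl
  -- Changing the samples amounts to translating the noise by the difference of the batch gradients.
  have hsub : ∀ ω, c z + (fun i => ν k i ω) = c z' + (c z - c z' + fun i => ν k i ω) :=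
    fun ω => by abel
  simp only [hc]
  simp only [hsub]
  refine (hν.lintegral_add_le hσ (c z - c z') (hf.comp (measurable_const_add (c z')))).trans ?_
  refine mul_le_mul_left (ENNReal.ofReal_le_ofReal (Real.exp_le_exp.2 ?_)) _
  rw [← div_div]
  gcongr
  exact h.sum_l1Norm_le

theorem LaplaceNoise.differentiallyPrivate_noisyGradients {n d : ℕ} {Ξ Ω : Type*}
    [MeasurableSpace Ω] {P : Measure Ω} [IsProbabilityMeasure P] {σ : ℕ → ℝ}
    {ν : ℕ → Fin n → Ω → Vec d} (hν : LaplaceNoise P σ ν) {k : ℕ} (hσ : 0 < σ k)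
    (g : Fin n → Vec d → Ξ → Vec d) (C : ℝ) (N : ℕ) (x : Fin n → Vec d) :
    DifferentiallyPrivate P (AdjacentSamples g C N x)
      (fun z ω => noisyGradients g N x z fun i => ν k i ω) (C / (N * σ k)) := by
  intro z z' h Υ hΥ
  have hm : ∀ z, Measurable fun ω => noisyGradients g N x z fun i => ν k i ω := fun z => by
    refine measurable_pi_lambda _ fun i => ?_
    exact (hν.measurable k i).const_add _
  have := hν.lintegral_noisyGradients_le hσ h
    (f := Υ.indicator 1) (measurable_one.indicator hΥ)
  have key : ∀ z, ∫⁻ ω, Υ.indicator (1 : (Fin n → Vec d) → ℝ≥0∞)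
      (noisyGradients g N x z fun i => ν k i ω) ∂P
      = P {ω | noisyGradients g N x z (fun i => ν k i ω) ∈ Υ} := fun z =>
    lintegral_indicator_one (hm z hΥ)
  rwa [key, key] at this

/-- Tonelli for independent variables: the past `X` can be frozen while the fresh noise `Y` is
integrated out. -/
theorem ProbabilityTheory.IndepFun.lintegral_comp_prodMk {Ω S T : Type*} [MeasurableSpace Ω]
    [MeasurableSpace S] [MeasurableSpace T] {P : Measure Ω} [IsProbabilityMeasure P]
    {X : Ω → S} {Y : Ω → T} (h : IndepFun X Y P) (hX : Measurable X) (hY : Measurable Y)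
    {f : S × T → ℝ≥0∞} (hf : Measurable f) :
    ∫⁻ ω, f (X ω, Y ω) ∂P = ∫⁻ ω, ∫⁻ ω', f (X ω, Y ω') ∂P ∂P := by
  have := Measure.isProbabilityMeasure_map (μ := P) hY.aemeasurable
  rw [← lintegral_map hf (hX.prodMk hY), h.map_prod_eq_prod_map_map hX.aemeasurable
    hY.aemeasurable, lintegral_prod _ hf.aemeasurable,
    lintegral_map hf.lintegral_prod_right' hX]
  refine lintegral_congr fun ω => ?_
  exact lintegral_map (hf.comp measurable_prodMk_left) hY

/-! ### Adaptive composition over finitely many iterations. -/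

/-- The sequence that agrees with `s` before `K` and is constantly `s₀` from `K` on. -/
def truncate {S : Type*} (s₀ : S) (K : ℕ) (s : ℕ → S) : ℕ → S :=
  fun j => if j < K then s j else s₀

theorem truncate_of_lt {S : Type*} (s₀ : S) {K j : ℕ} (s : ℕ → S) (h : j < K) :
    truncate s₀ K s j = s j := if_pos h

theorem truncate_congr {S : Type*} (s₀ : S) {K : ℕ} {s s' : ℕ → S} (h : ∀ j < K, s j = s' j) :
    truncate s₀ K s = truncate s₀ K s' := by
  funext j
  by_cases hj : j < K
  · simp [truncate, hj, h j hj]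
  · simp [truncate, hj]

theorem truncate_succ {S : Type*} (s₀ : S) (K : ℕ) (s : ℕ → S) :
    truncate s₀ (K + 1) s = Function.update (truncate s₀ K s) K (s K) := by
  funext j
  rcases lt_trichotomy j K with h | rfl | h
  · rw [Function.update_of_ne h.ne, truncate_of_lt _ _ h, truncate_of_lt _ _ (by omega)]
  · rw [Function.update_self, truncate_of_lt _ _ (by omega)]
  · rw [Function.update_of_ne h.ne']
    simp [truncate, not_lt.2 h.le, show ¬ j < K + 1 by omega]

theorem measurable_truncate {S : Type*} [MeasurableSpace S] (s₀ : S) (K : ℕ) :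
    Measurable (truncate s₀ K) := by
  refine measurable_pi_lambda _ fun j => ?_
  by_cases hj : j < K
  · simpa [truncate, hj] using measurable_pi_apply j
  · simp [truncate, hj]

/-- The noises of one iteration are independent of those of the earlier ones. -/
theorem LaplaceNoise.indepFun_truncate {n d : ℕ} {Ω : Type*} [MeasurableSpace Ω]
    {P : Measure Ω} {σ : ℕ → ℝ} {ν : ℕ → Fin n → Ω → Vec d} (hν : LaplaceNoise P σ ν) (K : ℕ) :
    IndepFun (fun ω => truncate 0 K fun k i => ν k i ω) (fun ω i => ν K i ω) P := by
  let S : Finset (ℕ × Fin n × Fin d) := Finset.range K ×ˢ Finset.univ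
  let T : Finset (ℕ × Fin n × Fin d) := {K} ×ˢ Finset.univ
  have hST : Disjoint S T := by
    rw [Finset.disjoint_left]
    intro p hp hp'
    simp only [S, T, Finset.mem_product, Finset.mem_range, Finset.mem_singleton] at hp hp'
    omega
  have h := hν.indep.indepFun_finset S T hST fun p => by
    have := hν.measurable p.1 p.2.1
    fun_prop
  -- The value `0` outside `S` is the default of `truncate 0 K`, so `φ` recovers exactly the
  -- truncated noises.
  let φ : (S → ℝ) → ℕ → Fin n → Vec d := fun u k i =>
    WithLp.toLp 2 fun j => if hp : (k, i, j) ∈ S then u ⟨_, hp⟩ else 0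
  let ψ : (T → ℝ) → Fin n → Vec d := fun u i =>
    WithLp.toLp 2 fun j => u ⟨(K, i, j), by simp [T]⟩
  have hφ : Measurable φ := by
    refine measurable_pi_lambda _ fun k => measurable_pi_lambda _ fun i =>
      (WithLp.measurable_toLp 2 _).comp (measurable_pi_lambda _ fun j => ?_)
    by_cases hp : (k, i, j) ∈ S
    · simpa [hp] using measurable_pi_apply _
    · simp [hp]
  have hψ : Measurable ψ :=
    measurable_pi_lambda _ fun i => (WithLp.measurable_toLp 2 _).comp
      (measurable_pi_lambda _ fun j => measurable_pi_apply _)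
  have h' := h.comp hφ hψ
  convert h' using 1
  · funext ω k
    ext i j
    by_cases hk : k < K
    · simp [φ, S, truncate, hk]
    · simp [φ, S, truncate, hk]
  · rfl

section Algorithm

variable {n d : ℕ} {Ξ : Type*} (A : Matrix (Fin n) (Fin n) ℝ) (α β : ℕ → ℝ) (γ : ℕ → ℕ)
  (g : Fin n → Vec d → Ξ → Vec d) (x₀ : Fin n → Vec d)

theorem algState_congr {z z' : ℕ → (Fin n → Vec d) → Fin n → ℕ → Ξ} {ν ν' : ℕ → Fin n → Vec d} :
    ∀ {K : ℕ}, (∀ k < K, z k = z' k) → (∀ k < K, ν k = ν' k) →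
      algState A α β γ g x₀ z ν K = algState A α β γ g x₀ z' ν' K
  | 0, _, _ => rfl
  | K + 1, hz, hν => by
    funext i
    have ih := algState_congr (K := K) (fun k hk => hz k (by omega)) fun k hk => hν k (by omega)
    simp only [algState, ih, hz K (by omega), hν K (by omega)]

/-- The gradient released in iteration `k` already contains the noise of iteration `k`; hence the
strict inequality `k < K`. -/
theorem algTranscript_congr {z : ℕ → (Fin n → Vec d) → Fin n → ℕ → Ξ}
    {ν ν' : ℕ → Fin n → Vec d} {K k : ℕ} (hk : k < K) (hν : ∀ k < K, ν k = ν' k) :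
    algTranscript A α β γ g x₀ z ν k = algTranscript A α β γ g x₀ z ν' k := by
  have h : algState A α β γ g x₀ z ν k = algState A α β γ g x₀ z ν' k :=
    algState_congr A α β γ g x₀ (fun _ _ => rfl) fun j hj => hν j (by omega)
  simp only [algTranscript, h, hν k hk]

/-- One step of the algorithm, from a state and the perturbed gradients. -/
def updateState (a b : ℝ) (p : (Fin n → Vec d) × (Fin n → Vec d)) : Fin n → Vec d :=
  fun i => (1 - b) • p.1 i + b • ∑ j, A i j • p.1 j - a • p.2 i

theorem algState_succ (z : ℕ → (Fin n → Vec d) → Fin n → ℕ → Ξ) (ν : ℕ → Fin n → Vec d) (k : ℕ) :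
    algState A α β γ g x₀ z ν (k + 1)
      = updateState A (α k) (β k) (algTranscript A α β γ g x₀ z ν k) := rfl

/-- The state of iteration `k`, reconstructed from the released sequence before `k`. -/
def stateOfTranscript : ℕ → (ℕ → (Fin n → Vec d) × (Fin n → Vec d)) → Fin n → Vec d
  | 0, _ => x₀
  | k + 1, τ => updateState A (α k) (β k) (τ k)

/-- Releasing the states costs no privacy: each is determined by the initial values or by the
preceding output, without access to the data. -/
theorem stateOfTranscript_truncate (z : ℕ → (Fin n → Vec d) → Fin n → ℕ → Ξ)
    (ν : ℕ → Fin n → Vec d) :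
    ∀ k, stateOfTranscript A α β x₀ k (truncate 0 k (algTranscript A α β γ g x₀ z ν))
      = algState A α β γ g x₀ z ν k
  | 0 => rfl
  | k + 1 => by
    rw [stateOfTranscript, truncate_of_lt _ _ (Nat.lt_succ_self k), algState_succ]

variable [MeasurableSpace Ξ] {Θ : Type*} [MeasurableSpace Θ]

theorem measurable_noisyGradients (hg : ∀ i, Measurable (Function.uncurry (g i))) (N : ℕ)
    {x : Θ → Fin n → Vec d} {z : Θ → Fin n → ℕ → Ξ} {ν : Θ → Fin n → Vec d} (hx : Measurable x)
    (hz : ∀ i l, Measurable fun θ => z θ i l) (hν : Measurable ν) :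
    Measurable fun θ => noisyGradients g N (x θ) (z θ) (ν θ) := by
  refine measurable_pi_lambda _ fun i => ?_
  have h : Measurable fun θ => batchGradient (g i) N (x θ i) (z θ i) :=
    Measurable.fun_const_smul (Finset.measurable_sum _ fun l _ =>
      (hg i).comp (((measurable_pi_apply i).comp hx).prodMk (hz i l))) _
  exact h.add ((measurable_pi_apply i).comp hν)

theorem measurable_updateState (a b : ℝ) : Measurable (updateState (d := d) A a b) := by
  unfold updateState
  fun_prop

theorem measurable_algState (hg : ∀ i, Measurable (Function.uncurry (g i)))
    {z : Θ → ℕ → (Fin n → Vec d) → Fin n → ℕ → Ξ} {ν : Θ → ℕ → Fin n → Vec d}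
    (hz : ∀ k i l, Measurable fun p : Θ × (Fin n → Vec d) => z p.1 k p.2 i l)
    (hν : Measurable ν) :
    ∀ K, Measurable fun θ => algState A α β γ g x₀ (z θ) (ν θ) K
  | 0 => measurable_const
  | K + 1 => by
    have ih := measurable_algState hg hz hν K
    simp only [algState_succ]
    exact (measurable_updateState A _ _).comp (ih.prodMk (measurable_noisyGradients g hg _ ih
      (fun i l => (hz K i l).comp (measurable_id.prodMk ih)) ((measurable_pi_apply K).comp hν)))

theorem measurable_algTranscript (hg : ∀ i, Measurable (Function.uncurry (g i)))
    (D : DataStream n d Ξ) {ν : Θ → ℕ → Fin n → Vec d} (hν : Measurable ν) :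
    Measurable fun θ => algTranscript A α β γ g x₀ D.z (ν θ) := by
  refine measurable_pi_lambda _ fun K => ?_
  have hz : ∀ k i l, Measurable fun p : Θ × (Fin n → Vec d) => D.z k p.2 i l := fun k i l =>
    (measurable_pi_iff.1 (measurable_pi_iff.1 ((measurable_pi_iff.2 fun i =>
      measurable_pi_iff.2 fun l => D.measurable k i l)) i) l).comp measurable_snd
  have h := measurable_algState A α β γ g x₀ hg (z := fun _ => D.z) hz hν K
  exact h.prodMk (measurable_noisyGradients g hg _ h
    (fun i l => (D.measurable K i l).comp h) ((measurable_pi_apply K).comp hν))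

theorem measurable_stateOfTranscript :
    ∀ k, Measurable (stateOfTranscript A α β x₀ k)
  | 0 => measurable_const
  | k + 1 => (measurable_updateState A _ _).comp (measurable_pi_apply k)

/-- Privacy of the first `K` iterations, in terms of expectations of nonnegative functions. -/
theorem LaplaceNoise.lintegral_truncate_algTranscript_le {Ω : Type*} [MeasurableSpace Ω]
    {P : Measure Ω} [IsProbabilityMeasure P] {σ : ℕ → ℝ} {ν : ℕ → Fin n → Ω → Vec d}
    (hν : LaplaceNoise P σ ν) (hσ : ∀ k, 0 < σ k)
    (hg : ∀ i, Measurable (Function.uncurry (g i))) {C : ℝ} {D D' : DataStream n d Ξ}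
    (h : AdjacentStreams g C γ D D') (K : ℕ) :
    ∀ {f : (ℕ → (Fin n → Vec d) × (Fin n → Vec d)) → ℝ≥0∞}, Measurable f →
      ∫⁻ ω, f (truncate 0 K (algTranscript A α β γ g x₀ D.z fun k i => ν k i ω)) ∂P
        ≤ ENNReal.ofReal (Real.exp (∑ k ∈ Finset.range K, C / (γ k * σ k)))
          * ∫⁻ ω, f (truncate 0 K (algTranscript A α β γ g x₀ D'.z fun k i => ν k i ω)) ∂P := by
  have hν_meas : Measurable fun ω => fun k i => ν k i ω :=
    measurable_pi_lambda _ fun k => measurable_pi_lambda _ fun i => hν.measurable k i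
  induction K with
  | zero =>
    intro f _
    have : ∀ τ τ' : ℕ → (Fin n → Vec d) × (Fin n → Vec d), truncate 0 0 τ = truncate 0 0 τ' :=
      fun τ τ' => truncate_congr _ fun j hj => absurd hj (Nat.not_lt_zero j)
    simp [this _ 0]
  | succ K ih =>
    intro f hf
    let s := stateOfTranscript A α β x₀ K
    have hs : Measurable s := measurable_stateOfTranscript A α β x₀ K
    let T : DataStream n d Ξ → Ω → ℕ → (Fin n → Vec d) × (Fin n → Vec d) := fun D ω =>
      truncate 0 K (algTranscript A α β γ g x₀ D.z fun k i => ν k i ω)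
    have hT : ∀ D, Measurable (T D) := fun D =>
      (measurable_truncate 0 K).comp (measurable_algTranscript A α β γ g x₀ hg D hν_meas)
    -- `F D` rebuilds the prefix of length `K + 1` from the prefix of length `K` and the fresh
    -- noise, which are independent.
    let F : DataStream n d Ξ → (ℕ → (Fin n → Vec d) × (Fin n → Vec d)) × (Fin n → Vec d) → ℝ≥0∞ :=
      fun D p => f (Function.update p.1 K
        (s p.1, noisyGradients g (γ K) (s p.1) (D.z K (s p.1)) p.2))
    have hF : ∀ D, Measurable (F D) := fun D => by
      refine hf.comp (measurable_pi_lambda _ fun j => ?_)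
      have hs1 : Measurable fun p : (ℕ → (Fin n → Vec d) × (Fin n → Vec d)) × (Fin n → Vec d) =>
          s p.1 := hs.comp measurable_fst
      by_cases hj : j = K
      · subst hj
        simp only [Function.update_self]
        exact hs1.prodMk (measurable_noisyGradients g hg _ hs1
          (fun i l => (D.measurable j i l).comp hs1) measurable_snd)
      · simp only [Function.update_of_ne hj]
        exact (measurable_pi_apply j).comp measurable_fst
    have hrec : ∀ D, ∫⁻ ω, f (truncate 0 (K + 1)
        (algTranscript A α β γ g x₀ D.z fun k i => ν k i ω)) ∂P
        = ∫⁻ ω, ∫⁻ ω', F D (T D ω, fun i => ν K i ω') ∂P ∂P := fun D => by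
      have hind : IndepFun (T D) (fun ω i => ν K i ω) P := by
        have hmeas : Measurable fun ν' : ℕ → Fin n → Vec d =>
            truncate 0 K (algTranscript A α β γ g x₀ D.z ν') :=
          (measurable_truncate 0 K).comp
            (measurable_algTranscript A α β γ g x₀ hg D measurable_id)
        have := (hν.indepFun_truncate K).comp hmeas measurable_id
        refine this.congr (.of_forall fun ω => ?_) (.of_forall fun ω => rfl)
        refine truncate_congr _ fun j hj => ?_
        exact algTranscript_congr A α β γ g x₀ hj fun k hk => truncate_of_lt _ _ hk
      rw [← hind.lintegral_comp_prodMk (hT D)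
        (measurable_pi_lambda _ fun i => hν.measurable K i) (hF D)]
      refine lintegral_congr fun ω => ?_
      have hst : s (T D ω) = algState A α β γ g x₀ D.z (fun k i => ν k i ω) K :=
        stateOfTranscript_truncate A α β γ g x₀ D.z _ K
      simp only [F, hst, truncate_succ]
      rfl
    have hFint : ∀ D, Measurable fun τ => ∫⁻ ω', F D (τ, fun i => ν K i ω') ∂P := fun D =>
      Measurable.lintegral_prod_right' (f := fun p : (ℕ → (Fin n → Vec d) × (Fin n → Vec d)) × Ω =>
        F D (p.1, fun i => ν K i p.2)) <| (hF D).comp <| measurable_fst.prodMk <|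
          measurable_pi_lambda _ fun i => (hν.measurable K i).comp measurable_snd
    rw [hrec D, hrec D', Finset.sum_range_succ, Real.exp_add,
      ENNReal.ofReal_mul (Real.exp_pos _).le]
    -- With the past `τ` frozen, both data streams face the same state `s τ`, so adjacency at that
    -- state is all that is needed.
    have hstep : ∀ τ, ∫⁻ ω', F D (τ, fun i => ν K i ω') ∂P
        ≤ ENNReal.ofReal (Real.exp (C / (γ K * σ K))) * ∫⁻ ω', F D' (τ, fun i => ν K i ω') ∂P :=
      fun τ => hν.lintegral_noisyGradients_le (hσ K) (h K (s τ))
        (f := fun y => f (Function.update τ K (s τ, y)))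
        (hf.comp ((measurable_update τ).comp measurable_prodMk_left))
    calc ∫⁻ ω, ∫⁻ ω', F D (T D ω, fun i => ν K i ω') ∂P ∂P
        ≤ ∫⁻ ω, ENNReal.ofReal (Real.exp (C / (γ K * σ K)))
            * ∫⁻ ω', F D' (T D ω, fun i => ν K i ω') ∂P ∂P := lintegral_mono fun ω => hstep _
      _ = ENNReal.ofReal (Real.exp (C / (γ K * σ K)))
            * ∫⁻ ω, ∫⁻ ω', F D' (T D ω, fun i => ν K i ω') ∂P ∂P :=
          lintegral_const_mul _ ((hFint D').comp (hT D))
      -- The induction hypothesis is applied to the partial integral of `F D'`, which is not an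
      -- indicator; this is why the bound is proved for all nonnegative functions.
      _ ≤ ENNReal.ofReal (Real.exp (C / (γ K * σ K)))
            * (ENNReal.ofReal (Real.exp (∑ k ∈ Finset.range K, C / (γ k * σ k)))
            * ∫⁻ ω, ∫⁻ ω', F D' (T D' ω, fun i => ν K i ω') ∂P ∂P) :=
          mul_le_mul_right (ih (hFint D')) _
      _ = _ := by rw [← mul_assoc, mul_comm (ENNReal.ofReal (Real.exp (C / (γ K * σ K))))]

end Algorithm

/-! ### From finite prefixes to the infinite run. -/

/-- Measures on a space of sequences are compared on the sets of finitely many coordinates. -/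
theorem MeasureTheory.Measure.le_smul_of_forall_truncate {S : Type*} [MeasurableSpace S] (s₀ : S)
    {μ ν : Measure (ℕ → S)} [IsFiniteMeasure μ] [IsFiniteMeasure ν] {c : ℝ≥0∞} (hc : c ≠ ∞)
    (h : ∀ K Υ, MeasurableSet Υ → μ (truncate s₀ K ⁻¹' Υ) ≤ c * ν (truncate s₀ K ⁻¹' Υ))
    {Υ : Set (ℕ → S)} (hΥ : MeasurableSet Υ) : μ Υ ≤ c * ν Υ := by
  -- Sets determined by finitely many coordinates. Demanding invariance for all `K' ≥ K` lets two
  -- sets share the larger index, which makes this a ring.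
  let 𝒞 : Set (Set (ℕ → S)) :=
    {t | ∃ K, ∀ K' ≥ K, MeasurableSet t ∧ truncate s₀ K' ⁻¹' t = t}
  have hmeas : ∀ t ∈ 𝒞, MeasurableSet t := fun t ⟨K, hK⟩ => (hK K le_rfl).1
  have hring : IsSetRing 𝒞 := by
    refine ⟨⟨0, fun _ _ => ⟨.empty, rfl⟩⟩, ?_, ?_⟩
    · rintro s t ⟨K, hK⟩ ⟨K', hK'⟩
      refine ⟨max K K', fun k hk => ?_⟩
      have h1 := hK k (le_of_max_le_left hk)
      have h2 := hK' k (le_of_max_le_right hk)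
      exact ⟨h1.1.union h2.1, by rw [Set.preimage_union, h1.2, h2.2]⟩
    · rintro s t ⟨K, hK⟩ ⟨K', hK'⟩
      refine ⟨max K K', fun k hk => ?_⟩
      have h1 := hK k (le_of_max_le_left hk)
      have h2 := hK' k (le_of_max_le_right hk)
      exact ⟨h1.1.diff h2.1, by rw [Set.preimage_sdiff, h1.2, h2.2]⟩
  have hgen : (MeasurableSpace.pi : MeasurableSpace (ℕ → S)) = .generateFrom 𝒞 := by
    refine le_antisymm (iSup_le fun j => ?_) (MeasurableSpace.generateFrom_le hmeas)
    rw [MeasurableSpace.comap_le_iff_le_map]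
    intro t ht
    refine MeasurableSpace.measurableSet_generateFrom ⟨j + 1, fun K hK => ?_⟩
    refine ⟨measurable_pi_apply j ht, ?_⟩
    ext τ
    simp [truncate_of_lt s₀ τ (show j < K by omega)]
  have hcov : ∃ D : Set (Set (ℕ → S)), D.Countable ∧ D ⊆ 𝒞 ∧ (μ + ν) (⋃₀ D)ᶜ = 0 := by
    refine ⟨{Set.univ}, Set.countable_singleton _, ?_, by simp⟩
    rintro t rfl
    exact ⟨0, fun _ _ => ⟨.univ, rfl⟩⟩
  refine ENNReal.le_of_forall_pos_le_add fun ε hε _ => ?_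
  obtain ⟨δ, hδ, hδε⟩ : ∃ δ : ℝ≥0∞, 0 < δ ∧ δ + c * δ ≤ ε := by
    refine ⟨ε / (1 + c), ENNReal.div_pos (by positivity) (by finiteness), ?_⟩
    rw [← one_add_mul]
    exact ENNReal.mul_div_le
  -- Approximation with respect to `μ + ν` gives one cylinder set good for both measures; the errors
  -- add up to `δ + c * δ ≤ ε`.
  obtain ⟨t, ⟨K, hK⟩, htΥ⟩ := exists_measure_symmDiff_lt_of_generateFrom_isSetRing
    (μ := μ + ν) hring hcov hgen hΥ hδ
  have ht := h K t (hK K le_rfl).1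
  rw [(hK K le_rfl).2] at ht
  have hμ : μ (t ∆ Υ) ≤ δ := (le_add_right le_rfl).trans htΥ.le
  have hν : ν (t ∆ Υ) ≤ δ := (le_add_left le_rfl).trans htΥ.le
  have h1 : μ Υ ≤ μ t + δ := by
    refine (measure_mono (t := t ∪ t ∆ Υ) ?_).trans ((measure_union_le _ _).trans (by gcongr))
    intro x hx
    by_cases hxt : x ∈ t
    · exact .inl hxt
    · exact .inr (.inr ⟨hx, hxt⟩)
  have h2 : ν t ≤ ν Υ + δ := by
    refine (measure_mono (t := Υ ∪ t ∆ Υ) ?_).trans ((measure_union_le _ _).trans (by gcongr))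
    intro x hx
    by_cases hxt : x ∈ Υ
    · exact .inl hxt
    · exact .inr (.inl ⟨hx, hxt⟩)
  calc μ Υ ≤ c * (ν Υ + δ) + δ := h1.trans (by gcongr; exact ht.trans (by gcongr))
    _ = c * ν Υ + (δ + c * δ) := by ring
    _ ≤ c * ν Υ + ε := by gcongr

/-- Every partial sum of the costs is at most the sum of the series, so all finite prefixes obey one
bound, which extends to all measurable sets. -/
theorem LaplaceNoise.differentiallyPrivate_algTranscript {n d : ℕ} {Ξ Ω : Type*}
    [MeasurableSpace Ξ] [MeasurableSpace Ω] (A : Matrix (Fin n) (Fin n) ℝ) (α β : ℕ → ℝ)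
    (γ : ℕ → ℕ) (g : Fin n → Vec d → Ξ → Vec d) (x₀ : Fin n → Vec d)
    {P : Measure Ω} [IsProbabilityMeasure P] {σ : ℕ → ℝ} {ν : ℕ → Fin n → Ω → Vec d}
    (hν : LaplaceNoise P σ ν) (hσ : ∀ k, 0 < σ k)
    (hg : ∀ i, Measurable (Function.uncurry (g i))) {C : ℝ} (hC : 0 ≤ C)
    (hsum : Summable fun k => C / (γ k * σ k)) :
    DifferentiallyPrivate P (AdjacentStreams g C γ)
      (fun (D : DataStream n d Ξ) ω => algTranscript A α β γ g x₀ D.z fun k i => ν k i ω)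
      (∑' k, C / (γ k * σ k)) := by
  intro D D' hadj Υ hΥ
  have hν_meas : Measurable fun ω => fun k i => ν k i ω :=
    measurable_pi_lambda _ fun k => measurable_pi_lambda _ fun i => hν.measurable k i
  have hT : ∀ D : DataStream n d Ξ, Measurable fun ω =>
      algTranscript A α β γ g x₀ D.z fun k i => ν k i ω := fun D =>
    measurable_algTranscript A α β γ g x₀ hg D hν_meas
  have key := Measure.le_smul_of_forall_truncate 0
    (μ := P.map fun ω => algTranscript A α β γ g x₀ D.z fun k i => ν k i ω)
    (ν := P.map fun ω => algTranscript A α β γ g x₀ D'.z fun k i => ν k i ω)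
    (c := ENNReal.ofReal (Real.exp (∑' k, C / (γ k * σ k)))) ENNReal.ofReal_ne_top ?_ hΥ
  · rwa [Measure.map_apply (hT D) hΥ, Measure.map_apply (hT D') hΥ] at key
  · intro K Υ hΥ
    have hpre := measurable_truncate (0 : (Fin n → Vec d) × (Fin n → Vec d)) K hΥ
    rw [Measure.map_apply (hT D) hpre, Measure.map_apply (hT D') hpre]
    have := hν.lintegral_truncate_algTranscript_le A α β γ g x₀ hσ hg hadj K
      (measurable_one.indicator hΥ)
    have hind : ∀ D : DataStream n d Ξ, ∫⁻ ω,
        Υ.indicator (1 : (ℕ → (Fin n → Vec d) × (Fin n → Vec d)) → ℝ≥0∞)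
        (truncate 0 K (algTranscript A α β γ g x₀ D.z fun k i => ν k i ω)) ∂P
        = P ((fun ω => algTranscript A α β γ g x₀ D.z fun k i => ν k i ω) ⁻¹'
          (truncate 0 K ⁻¹' Υ)) := fun D => lintegral_indicator_one (hT D hpre)
    rw [hind, hind] at this
    refine this.trans ?_
    gcongr
    exact hsum.sum_le_tsum _ fun k _ => div_nonneg hC (mul_nonneg (Nat.cast_nonneg _) (hσ k).le)

/-! ### The scalar recursion behind convergence. -/

/-- A Robbins–Monro type recursion: the contraction `1 - u k` with `∑ u k = ∞` makes a
perturbation of order `o (u k)` vanish in the limit. -/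
theorem tendsto_zero_of_le_one_sub_mul_add {V u r : ℕ → ℝ} (hV : ∀ k, 0 ≤ V k)
    (hu0 : ∀ k, 0 ≤ u k) (hu1 : ∀ᶠ k in atTop, u k ≤ 1) (hu : ¬ Summable u)
    (hr : Tendsto r atTop (𝓝 0))
    (h : ∀ᶠ k in atTop, V (k + 1) ≤ (1 - u k) * V k + u k * r k) :
    Tendsto V atTop (𝓝 0) := by
  rw [tendsto_order]
  refine ⟨fun a ha => .of_forall fun k => ha.trans_le (hV k), fun a ha => ?_⟩
  obtain ⟨K, hK⟩ := eventually_atTop.1 ((hu1.and h).and (hr.eventually_lt_const (half_pos ha)))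
  -- Once `r k < a / 2`, the excess over the level `a / 2` is multiplied by at most `1 - u k ≤ exp
  -- (-u k)`.
  have hprod : ∀ m, V (K + m) - a / 2
      ≤ Real.exp (-∑ k ∈ Finset.range m, u (K + k)) * V K := by
    intro m
    induction m with
    | zero =>
      simp only [add_zero, Finset.range_zero, Finset.sum_empty, neg_zero, Real.exp_zero, one_mul]
      linarith
    | succ m ih =>
      obtain ⟨⟨h1, h2⟩, h3⟩ := hK (K + m) (by omega)
      have hexp : 1 - u (K + m) ≤ Real.exp (-u (K + m)) := Real.one_sub_le_exp_neg _
      rw [Finset.sum_range_succ, neg_add, Real.exp_add]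
      have hpos : 0 ≤ Real.exp (-∑ k ∈ Finset.range m, u (K + k)) * V K :=
        mul_nonneg (Real.exp_pos _).le (hV K)
      calc V (K + (m + 1)) - a / 2
          ≤ (1 - u (K + m)) * (V (K + m) - a / 2) := by
            have := mul_le_mul_of_nonneg_left h3.le (hu0 (K + m))
            rw [← add_assoc]
            linarith
        _ ≤ (1 - u (K + m)) * (Real.exp (-∑ k ∈ Finset.range m, u (K + k)) * V K) :=
            mul_le_mul_of_nonneg_left ih (by linarith)
        _ ≤ Real.exp (-u (K + m)) * (Real.exp (-∑ k ∈ Finset.range m, u (K + k)) * V K) :=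
            mul_le_mul_of_nonneg_right hexp hpos
        _ = _ := by ring
  have hsum : Tendsto (fun m => ∑ k ∈ Finset.range m, u (K + k)) atTop atTop := by
    refine (not_summable_iff_tendsto_nat_atTop_of_nonneg fun k => hu0 _).1 fun hs => hu ?_
    refine (summable_nat_add_iff K).1 (hs.congr fun k => ?_)
    rw [add_comm]
  have hlim : Tendsto (fun m => Real.exp (-∑ k ∈ Finset.range m, u (K + k)) * V K) atTop
      (𝓝 0) := by
    simpa using (Real.tendsto_exp_neg_atTop_nhds_zero.comp hsum).mul_const (V K)
  obtain ⟨M, hM⟩ := eventually_atTop.1 (hlim.eventually_lt_const (half_pos ha))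
  refine eventually_atTop.2 ⟨K + M, fun k hk => ?_⟩
  obtain ⟨m, rfl⟩ := Nat.exists_eq_add_of_le (show K ≤ k by omega)
  have h1 := hprod m
  have h2 := hM m (by omega)
  linarith

/-! ### Consensus on the network and the exact gradient step. -/

section Network

variable {E : Type*} [NormedAddCommGroup E] [InnerProductSpace ℝ E] {n : ℕ}

/-- Jensen's inequality for the squared norm. -/
theorem norm_sq_sum_smul_le {ι : Type*} (s : Finset ι) (w : ι → ℝ) (v : ι → E)
    (hw : ∀ i ∈ s, 0 ≤ w i) (hw1 : ∑ i ∈ s, w i = 1) :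
    ‖∑ i ∈ s, w i • v i‖ ^ 2 ≤ ∑ i ∈ s, w i * ‖v i‖ ^ 2 := by
  have h := ((convexOn_norm (convex_univ (𝕜 := ℝ) (E := E))).pow (fun x _ => norm_nonneg x)
    2).map_sum_le hw hw1 (p := v) fun i _ => Set.mem_univ _
  simpa using h

/-- The weighted disagreement between neighbours. -/
def disagreement {E : Type*} [NormedAddCommGroup E] (A : Matrix (Fin n) (Fin n) ℝ) (e : Fin n → E) : ℝ :=
  ∑ i, ∑ j, A i j * ‖e i - e j‖ ^ 2

variable {G : SimpleGraph (Fin n)} {A : Matrix (Fin n) (Fin n) ℝ}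

theorem NetworkWeights.nonneg (hA : NetworkWeights G A) (i j : Fin n) : 0 ≤ A i j := by
  obtain ⟨c, hc, h⟩ := hA.pos
  by_cases hij : i = j ∨ G.Adj i j
  · exact (hc.trans (h i j hij)).le
  · exact (hA.zero i j hij).ge

theorem NetworkWeights.disagreement_nonneg {E : Type*} [NormedAddCommGroup E]
    (hA : NetworkWeights G A) (e : Fin n → E) :
    0 ≤ disagreement A e :=
  Finset.sum_nonneg fun i _ => Finset.sum_nonneg fun j _ =>
    mul_nonneg (hA.nonneg i j) (sq_nonneg _)

/-- Expand the squares in the disagreement: unit row sums and unit column sums each turn one of the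
square terms into `∑ i, ‖e i‖ ^ 2`. Symmetry of `A` plays no role. -/
theorem NetworkWeights.sum_inner_eq (hA : NetworkWeights G A) (e : Fin n → E) :
    2 * ∑ i, inner ℝ (e i) (e i - ∑ j, A i j • e j) = disagreement A e := by
  have h1 : ∑ i, ∑ j, A i j * ‖e i‖ ^ 2 = ∑ i, ‖e i‖ ^ 2 := by
    simp [← Finset.sum_mul, hA.row_sum]
  have h2 : ∑ i, ∑ j, A i j * ‖e j‖ ^ 2 = ∑ i, ‖e i‖ ^ 2 := by
    rw [Finset.sum_comm]
    simp [← Finset.sum_mul, hA.col_sum]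
  have h3 : disagreement A e = ∑ i, ∑ j, A i j * ‖e i‖ ^ 2 + ∑ i, ∑ j, A i j * ‖e j‖ ^ 2
      - 2 * ∑ i, ∑ j, A i j * inner ℝ (e i) (e j) := by
    simp only [disagreement, Finset.mul_sum, ← Finset.sum_add_distrib, ← Finset.sum_sub_distrib]
    refine Finset.sum_congr rfl fun i _ => Finset.sum_congr rfl fun j _ => ?_
    rw [norm_sub_sq_real]
    ring
  rw [h3, h1, h2]
  simp only [inner_sub_right, inner_sum, inner_smul_right, real_inner_self_eq_norm_sq,
    Finset.sum_sub_distrib]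
  ring

/-- Since rows sum to one, the deviation from the weighted mean is a convex combination of
differences, and Jensen applies. -/
theorem NetworkWeights.sum_norm_sq_le (hA : NetworkWeights G A) (e : Fin n → E) :
    ∑ i, ‖e i - ∑ j, A i j • e j‖ ^ 2 ≤ disagreement A e := by
  refine Finset.sum_le_sum fun i _ => ?_
  have : e i - ∑ j, A i j • e j = ∑ j, A i j • (e i - e j) := by
    simp [smul_sub, Finset.sum_sub_distrib, ← Finset.sum_smul, hA.row_sum]
  rw [this]
  exact norm_sq_sum_smul_le _ _ _ (fun j _ => hA.nonneg i j) (hA.row_sum i)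

/-- A Poincaré inequality on a connected network. -/
theorem NetworkWeights.exists_sum_norm_sub_sq_le {E : Type*} [NormedAddCommGroup E]
    (hA : NetworkWeights G A) :
    ∃ c : ℝ, 0 < c ∧ ∀ (e : Fin n → E) (i₀ : Fin n),
      ∑ i, ‖e i - e i₀‖ ^ 2 ≤ c * disagreement A e := by
  have hwalk : ∀ i j, ∃ c : ℝ, 0 ≤ c ∧
      ∀ e : Fin n → E, ‖e i - e j‖ ^ 2 ≤ c * disagreement A e := by
    intro i j
    obtain ⟨w⟩ := hA.connected.preconnected i j
    induction w with
    | nil => exact ⟨0, le_rfl, fun e => by simp⟩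
    | @cons i k j hik _ ih =>
      obtain ⟨c, hc, hce⟩ := ih
      obtain ⟨a, ha, hAa⟩ := hA.pos
      have hpos : 0 < A i k := ha.trans (hAa i k (.inr hik))
      -- The first edge of the walk is one term of the disagreement; the factors 2 come from
      -- splitting the square of a sum.
      refine ⟨2 * (A i k)⁻¹ + 2 * c, by positivity, fun e => ?_⟩
      have h1 : A i k * ‖e i - e k‖ ^ 2 ≤ disagreement A e :=
        (Finset.single_le_sum (f := fun k => A i k * ‖e i - e k‖ ^ 2)
          (fun j _ => mul_nonneg (hA.nonneg i j) (sq_nonneg _)) (Finset.mem_univ k)).trans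
        (Finset.single_le_sum (f := fun i => ∑ j, A i j * ‖e i - e j‖ ^ 2)
          (fun i _ => Finset.sum_nonneg fun j _ => mul_nonneg (hA.nonneg i j) (sq_nonneg _))
          (Finset.mem_univ i))
      have h2 : ‖e i - e k‖ ^ 2 ≤ (A i k)⁻¹ * disagreement A e := by
        rw [inv_mul_eq_div, le_div_iff₀' hpos]
        exact h1
      have h3 : ‖e i - e j‖ ≤ ‖e i - e k‖ + ‖e k - e j‖ := norm_sub_le_norm_sub_add_norm_sub _ _ _
      have h4 : ‖e i - e j‖ ^ 2 ≤ 2 * ‖e i - e k‖ ^ 2 + 2 * ‖e k - e j‖ ^ 2 := by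
        nlinarith [norm_nonneg (e i - e j), sq_nonneg (‖e i - e k‖ - ‖e k - e j‖)]
      linarith [hce e]
  choose c hc hce using hwalk
  -- The summand 1 keeps the constant positive even if all walk constants vanish, as for a single
  -- agent.
  refine ⟨∑ i, ∑ j, c i j + 1, ?_, fun e i₀ => ?_⟩
  · have := Finset.sum_nonneg fun i (_ : i ∈ Finset.univ) =>
      Finset.sum_nonneg fun j (_ : j ∈ Finset.univ) => hc i j
    linarith
  · calc ∑ i, ‖e i - e i₀‖ ^ 2 ≤ ∑ i, c i i₀ * disagreement A e :=
        Finset.sum_le_sum fun i _ => hce i i₀ e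
      _ = (∑ i, c i i₀) * disagreement A e := by rw [Finset.sum_mul]
      _ ≤ (∑ i, ∑ j, c i j + 1) * disagreement A e := by
        refine mul_le_mul_of_nonneg_right ?_ (hA.disagreement_nonneg e)
        have : ∑ i, c i i₀ ≤ ∑ i, ∑ j, c i j := Finset.sum_le_sum fun i _ =>
          Finset.single_le_sum (fun j _ => hc i j) (Finset.mem_univ i₀)
        linarith

/-- One exact gradient step decreases the sum of the squared distances to a zero `p` of the sum
of the strongly monotone vector fields `Φ i`, up to an error of order `a ^ 2 / b`. -/
theorem NetworkWeights.exists_sum_norm_step_sq_le (hA : NetworkWeights G A)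
    {Φ : Fin n → E → E} {L : Fin n → ℝ} {μ : ℝ} (hμ : 0 < μ)
    (hL : ∀ i x y, ‖Φ i x - Φ i y‖ ≤ L i * ‖x - y‖)
    (hΦ : ∀ i x y, μ * ‖x - y‖ ^ 2 ≤ inner ℝ (Φ i x - Φ i y) (x - y))
    {p : E} (hp : ∑ i, Φ i p = 0) :
    ∃ C a₀ : ℝ, 0 ≤ C ∧ 0 < a₀ ∧ ∀ a b : ℝ, 0 < a → a ≤ a₀ → 0 < b → b ≤ 1 / 4 →
      ∀ x : Fin n → E,
        ∑ i, ‖(1 - b) • x i + b • ∑ j, A i j • x j - a • Φ i (x i) - p‖ ^ 2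
          ≤ (1 - a * μ) * ∑ i, ‖x i - p‖ ^ 2 + C * (a ^ 2 / b) := by
  obtain ⟨c, hc, hpoinc⟩ := hA.exists_sum_norm_sub_sq_le (E := E)
  obtain ⟨i₀⟩ := hA.connected.nonempty
  set H : ℝ := ∑ i, ‖Φ i p‖ ^ 2 with hH
  have hH0 : 0 ≤ H := Finset.sum_nonneg fun i _ => sq_nonneg _
  set M : ℝ := ∑ i, L i ^ 2 + 1 with hM
  have hM0 : 0 < M := by
    have := Finset.sum_nonneg fun i (_ : i ∈ Finset.univ) => sq_nonneg (L i)
    linarith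
  have hLM : ∀ i, L i ^ 2 ≤ M := fun i => by
    have := Finset.single_le_sum (fun i _ => sq_nonneg (L i)) (Finset.mem_univ i)
    linarith
  -- In `C`, the part `2 * c` pays for the drift of the single gradients at `p`, and 1 for `4 * a ^
  -- 2 * H`, as `b ≤ 1 / 4`. The bound on `a` makes `4 * a ^ 2 * M ≤ a * μ`, so half of the
  -- contraction `2 * a * μ` survives.
  refine ⟨(2 * c + 1) * H, μ / (4 * M), by positivity, by positivity, ?_⟩
  intro a b ha ha₀ hb hb₁ x
  set e : Fin n → E := fun i => x i - p with he
  set κ : Fin n → E := fun i => e i - ∑ j, A i j • e j with hκ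
  have hstep : ∀ i, (1 - b) • x i + b • ∑ j, A i j • x j - a • Φ i (x i) - p
      = e i - (b • κ i + a • Φ i (x i)) := fun i => by
    have : ∑ j, A i j • e j = ∑ j, A i j • x j - p := by
      simp [he, smul_sub, Finset.sum_sub_distrib, ← Finset.sum_smul, hA.row_sum]
    simp only [hκ]
    rw [this]
    simp only [he]
    module
  have hterm : ∀ i, ‖e i - (b • κ i + a • Φ i (x i))‖ ^ 2
      ≤ (1 - a * μ) * ‖e i‖ ^ 2 - b * (2 * inner ℝ (e i) (κ i)) - 2 * a * inner ℝ (e i) (Φ i p)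
        + 2 * b ^ 2 * ‖κ i‖ ^ 2 + 4 * a ^ 2 * ‖Φ i p‖ ^ 2 := fun i => by
    have h1 : inner ℝ (e i) (Φ i (x i))
        = inner ℝ (Φ i (x i) - Φ i p) (x i - p) + inner ℝ (e i) (Φ i p) := by
      rw [real_inner_comm (x i - p)]
      change _ = inner ℝ (e i) _ + _
      rw [← inner_add_right, sub_add_cancel]
    have h2 := hΦ i (x i) p
    have h3 : ‖b • κ i + a • Φ i (x i)‖ ^ 2
        ≤ 2 * b ^ 2 * ‖κ i‖ ^ 2 + 2 * a ^ 2 * ‖Φ i (x i)‖ ^ 2 := by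
      have := norm_add_le (b • κ i) (a • Φ i (x i))
      rw [norm_smul, norm_smul, Real.norm_of_nonneg hb.le, Real.norm_of_nonneg ha.le] at this
      nlinarith [norm_nonneg (b • κ i + a • Φ i (x i)),
        sq_nonneg (b * ‖κ i‖ - a * ‖Φ i (x i)‖)]
    have h4 : ‖Φ i (x i)‖ ^ 2 ≤ 2 * (M * ‖e i‖ ^ 2) + 2 * ‖Φ i p‖ ^ 2 := by
      have h5 : ‖Φ i (x i)‖ ≤ ‖Φ i (x i) - Φ i p‖ + ‖Φ i p‖ := by
        simpa using norm_add_le (Φ i (x i) - Φ i p) (Φ i p)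
      have h6 : ‖Φ i (x i) - Φ i p‖ ^ 2 ≤ M * ‖e i‖ ^ 2 := by
        calc ‖Φ i (x i) - Φ i p‖ ^ 2 ≤ (L i * ‖x i - p‖) ^ 2 :=
              pow_le_pow_left₀ (norm_nonneg _) (hL i _ _) 2
          _ = L i ^ 2 * ‖e i‖ ^ 2 := by rw [mul_pow]
          _ ≤ M * ‖e i‖ ^ 2 := mul_le_mul_of_nonneg_right (hLM i) (sq_nonneg _)
      nlinarith [norm_nonneg (Φ i (x i)), sq_nonneg (‖Φ i (x i) - Φ i p‖ - ‖Φ i p‖)]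
    have h7 : 4 * a ^ 2 * M * ‖e i‖ ^ 2 ≤ a * μ * ‖e i‖ ^ 2 := by
      refine mul_le_mul_of_nonneg_right ?_ (sq_nonneg _)
      rw [le_div_iff₀ (by positivity)] at ha₀
      nlinarith
    have h8 := mul_le_mul_of_nonneg_left h2 ha.le
    have h9 := mul_le_mul_of_nonneg_left h4 (sq_nonneg a)
    rw [norm_sub_sq_real, inner_add_right, inner_smul_right, inner_smul_right, h1]
    change a * (μ * ‖e i‖ ^ 2) ≤ _ at h8
    linarith
  -- As the `Φ i p` sum to zero, `e i` may be replaced by `e i - e i₀`. Young's inequality with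
  -- weight `b / (2 * c)` and the Poincaré inequality then use half of the available `b *
  -- disagreement A e`; the other half absorbs `2 * b ^ 2 * ∑ i, ‖κ i‖ ^ 2`.
  have hinner : -(2 * a * ∑ i, inner ℝ (e i) (Φ i p))
      ≤ b / 2 * disagreement A e + 2 * c * (a ^ 2 / b) * H := by
    have h1 : ∑ i, inner ℝ (e i) (Φ i p) = ∑ i, inner ℝ (e i - e i₀) (Φ i p) := by
      simp [inner_sub_left, Finset.sum_sub_distrib, ← inner_sum, hp]
    have h2 : ∀ i, -(2 * a * inner ℝ (e i - e i₀) (Φ i p))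
        ≤ b / (2 * c) * ‖e i - e i₀‖ ^ 2 + 2 * c * (a ^ 2 / b) * ‖Φ i p‖ ^ 2 := fun i => by
      have h3 : -inner ℝ (e i - e i₀) (Φ i p) ≤ ‖e i - e i₀‖ * ‖Φ i p‖ :=
        (neg_le_abs _).trans (abs_real_inner_le_norm _ _)
      have h4 : b / (2 * c) * ‖e i - e i₀‖ ^ 2 + 2 * c * (a ^ 2 / b) * ‖Φ i p‖ ^ 2
          - 2 * a * (‖e i - e i₀‖ * ‖Φ i p‖)
          = b / (2 * c) * (‖e i - e i₀‖ - 2 * c * a / b * ‖Φ i p‖) ^ 2 := by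
        field_simp
        ring
      have h5 : 0 ≤ b / (2 * c) * (‖e i - e i₀‖ - 2 * c * a / b * ‖Φ i p‖) ^ 2 := by positivity
      have h6 := mul_le_mul_of_nonneg_left h3 (show 0 ≤ 2 * a by positivity)
      linarith
    have h3 := mul_le_mul_of_nonneg_left (hpoinc e i₀) (show 0 ≤ b / (2 * c) by positivity)
    have h4 : b / (2 * c) * (c * disagreement A e) = b / 2 * disagreement A e := by
      field_simp
    calc -(2 * a * ∑ i, inner ℝ (e i) (Φ i p))
        = ∑ i, -(2 * a * inner ℝ (e i - e i₀) (Φ i p)) := by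
          rw [h1, Finset.mul_sum, Finset.sum_neg_distrib]
      _ ≤ ∑ i, (b / (2 * c) * ‖e i - e i₀‖ ^ 2 + 2 * c * (a ^ 2 / b) * ‖Φ i p‖ ^ 2) :=
          Finset.sum_le_sum fun i _ => h2 i
      _ = b / (2 * c) * ∑ i, ‖e i - e i₀‖ ^ 2 + 2 * c * (a ^ 2 / b) * H := by
          rw [Finset.sum_add_distrib, Finset.mul_sum, Finset.mul_sum]
      _ ≤ _ := by linarith
  have hsum := Finset.sum_le_sum fun i (_ : i ∈ Finset.univ) => hterm i
  simp only [Finset.sum_add_distrib, Finset.sum_sub_distrib, ← Finset.mul_sum] at hsum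
  rw [hA.sum_inner_eq e, ← hH] at hsum
  have hκE : ∑ i, ‖κ i‖ ^ 2 ≤ disagreement A e := hA.sum_norm_sq_le e
  have hE := hA.disagreement_nonneg e
  have hb2 : 2 * b ^ 2 * ∑ i, ‖κ i‖ ^ 2 ≤ b / 2 * disagreement A e := by
    calc 2 * b ^ 2 * ∑ i, ‖κ i‖ ^ 2 ≤ 2 * b ^ 2 * disagreement A e := by gcongr
      _ ≤ b / 2 * disagreement A e := by
        refine mul_le_mul_of_nonneg_right ?_ hE
        nlinarith
  have ha2 : 4 * a ^ 2 * H ≤ a ^ 2 / b * H := by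
    refine mul_le_mul_of_nonneg_right ?_ hH0
    rw [le_div_iff₀ hb]
    nlinarith [sq_nonneg a]
  rw [Finset.sum_congr rfl fun i _ => by rw [hstep i]]
  linarith

end Network

/-! ### Existence of a minimizer. -/

/-- A Lipschitz and strongly monotone vector field has a zero. -/
theorem exists_eq_zero_of_strongly_monotone {E : Type*} [NormedAddCommGroup E]
    [InnerProductSpace ℝ E] [CompleteSpace E] {Φ : E → E} {L μ : ℝ} (hμ : 0 < μ)
    (hL : ∀ x y, ‖Φ x - Φ y‖ ≤ L * ‖x - y‖)
    (hΦ : ∀ x y, μ * ‖x - y‖ ^ 2 ≤ inner ℝ (Φ x - Φ y) (x - y)) : ∃ p, Φ p = 0 := by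
  -- Banach's fixed point theorem for `x - t • Φ x`: the squared Lipschitz constant `1 - 2 * t * μ +
  -- t ^ 2 * M ^ 2` is least at `t = μ / M ^ 2`, with value `1 - t * μ`. Adding `μ` to `|L|` gives
  -- `μ ≤ M`, so this value is nonnegative.
  set M : ℝ := |L| + μ with hM
  have hMpos : 0 < M := by positivity
  have hLM : ∀ x y, ‖Φ x - Φ y‖ ≤ M * ‖x - y‖ := fun x y =>
    (hL x y).trans (mul_le_mul_of_nonneg_right (by linarith [le_abs_self L]) (norm_nonneg _))
  set t : ℝ := μ / M ^ 2 with ht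
  have htpos : 0 < t := by positivity
  have hq0 : 0 ≤ 1 - t * μ := by
    have hle : μ ^ 2 ≤ M ^ 2 := pow_le_pow_left₀ hμ.le (by linarith [abs_nonneg L]) 2
    have : t * μ = μ ^ 2 / M ^ 2 := by rw [ht]; ring
    rw [this, sub_nonneg, div_le_one (by positivity)]
    exact hle
  have hcontr : ContractingWith (Real.toNNReal (Real.sqrt (1 - t * μ))) fun x => x - t • Φ x := by
    refine ⟨?_, LipschitzWith.of_dist_le_mul fun x y => ?_⟩
    · rw [← Real.toNNReal_one]
      refine (Real.toNNReal_lt_toNNReal_iff one_pos).2 ?_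
      rw [Real.sqrt_lt' one_pos]
      have : 0 < t * μ := by positivity
      linarith
    · rw [Real.coe_toNNReal _ (Real.sqrt_nonneg _), dist_eq_norm, dist_eq_norm]
      refine abs_le_of_sq_le_sq' ?_ (by positivity) |>.2
      rw [mul_pow, Real.sq_sqrt hq0]
      have h1 : x - t • Φ x - (y - t • Φ y) = (x - y) - t • (Φ x - Φ y) := by
        rw [smul_sub]
        abel
      have h2 := hΦ x y
      have h3 : ‖Φ x - Φ y‖ ^ 2 ≤ M ^ 2 * ‖x - y‖ ^ 2 := by
        rw [← mul_pow]
        exact pow_le_pow_left₀ (norm_nonneg _) (hLM x y) 2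
      have h4 : t ^ 2 * M ^ 2 = t * μ := by
        rw [ht]
        field_simp
      rw [h1, norm_sub_sq_real, inner_smul_right, norm_smul, mul_pow, Real.norm_of_nonneg htpos.le,
        real_inner_comm]
      have h5 := mul_le_mul_of_nonneg_left h2 htpos.le
      have h6 := mul_le_mul_of_nonneg_left h3 (sq_nonneg t)
      have h7 : t ^ 2 * (M ^ 2 * ‖x - y‖ ^ 2) = t * μ * ‖x - y‖ ^ 2 := by rw [← mul_assoc, h4]
      linarith
  refine ⟨hcontr.fixedPoint, ?_⟩
  have hfix := hcontr.fixedPoint_isFixedPt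
  have : t • Φ hcontr.fixedPoint = 0 := by
    have h := hfix.eq
    simpa using h
  exact (smul_eq_zero.1 this).resolve_left htpos.ne'

/-- A zero of a strongly monotone gradient is a minimizer. -/
theorem le_of_gradient_monotone {E : Type*} [NormedAddCommGroup E] [InnerProductSpace ℝ E]
    [CompleteSpace E] {f : E → ℝ} {Φ : E → E} (hf : ∀ x, HasGradientAt f (Φ x) x)
    (hΦ : ∀ x y, 0 ≤ inner ℝ (Φ x - Φ y) (x - y)) {p : E} (hp : Φ p = 0) (x : E) : f p ≤ f x := by
  have hderiv : ∀ t : ℝ, HasDerivAt (fun t : ℝ => f (p + t • (x - p)))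
      (inner ℝ (Φ (p + t • (x - p))) (x - p)) t := fun t => by
    have h1 : HasDerivAt (fun t : ℝ => p + t • (x - p)) (x - p) t := by
      simpa using ((hasDerivAt_id t).smul_const (x - p)).const_add p
    have h2 := (hf (p + t • (x - p))).hasFDerivAt.comp_hasDerivAt t h1
    simpa [Function.comp_def] using h2
  -- By the mean value theorem on the segment from `p` to `x`, `f x - f p` is a directional
  -- derivative at an inner point; monotonicity against `Φ p = 0` makes it nonnegative, as `t > 0`.
  obtain ⟨t, ht, hslope⟩ := exists_hasDerivAt_eq_slope (fun t : ℝ => f (p + t • (x - p)))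
    (fun t => inner ℝ (Φ (p + t • (x - p))) (x - p)) zero_lt_one
    (fun t _ => (hderiv t).continuousAt.continuousWithinAt) fun t _ => hderiv t
  have hmono := hΦ (p + t • (x - p)) p
  rw [hp, sub_zero, add_sub_cancel_left, inner_smul_right] at hmono
  have hnonneg := nonneg_of_mul_nonneg_right hmono ht.1
  rw [hslope] at hnonneg
  simp at hnonneg
  linarith

/-- The total cost has a minimizer, at which the gradients of the agents sum up to zero. -/
theorem exists_minimizer {n d : ℕ} [NeZero n] {f : Fin n → Vec d → ℝ} {L : Fin n → ℝ} {μ : ℝ}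
    (hμ : 0 < μ) (hf : ∀ i, SmoothStronglyConvex (f i) (L i) μ) :
    ∃ p : Vec d, ∑ i, gradient (f i) p = 0 ∧ ∀ x, ∑ i, f i p ≤ ∑ i, f i x := by
  have hmono : ∀ x y, ∑ _i : Fin n, μ * ‖x - y‖ ^ 2
      ≤ inner ℝ (∑ i, gradient (f i) x - ∑ i, gradient (f i) y) (x - y) := fun x y => by
    rw [← Finset.sum_sub_distrib, sum_inner]
    exact Finset.sum_le_sum fun i _ => (hf i).stronglyConvex x y
  have hn : (0 : ℝ) < n := Nat.cast_pos.2 (NeZero.pos n)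
  obtain ⟨p, hp⟩ := exists_eq_zero_of_strongly_monotone
    (Φ := fun x => ∑ i, gradient (f i) x) (L := ∑ i, L i) (mul_pos hn hμ)
    (fun x y => by
      rw [← Finset.sum_sub_distrib, Finset.sum_mul]
      exact (norm_sum_le _ _).trans (Finset.sum_le_sum fun i _ => (hf i).lipschitz x y))
    (fun x y => by simpa [mul_assoc] using hmono x y)
  refine ⟨p, hp, fun x => ?_⟩
  refine le_of_gradient_monotone (f := fun x => ∑ i, f i x)
    (Φ := fun x => ∑ i, gradient (f i) x) (fun x => ?_) (fun x y => ?_) hp x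
  · rw [hasGradientAt_iff_hasFDerivAt, map_sum]
    exact HasFDerivAt.fun_sum fun i _ => ((hf i).differentiable x).hasGradientAt.hasFDerivAt
  · exact le_trans (Finset.sum_nonneg fun i _ => by positivity) (hmono x y)

/-! ### Moments of the Laplace noise. -/

section Laplace

theorem toReal_laplaceDensity {b : ℝ} (hb : 0 < b) (t : ℝ) :
    (ENNReal.ofReal ((2 * b)⁻¹ * Real.exp (-|t| / b))).toReal
      = (2 * b)⁻¹ * Real.exp (-|t| / b) :=
  ENNReal.toReal_ofReal (by positivity)

theorem integral_sq_laplaceMeasure {b : ℝ} (hb : 0 < b) :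
    ∫ t, t ^ 2 ∂laplaceMeasure b = 2 * b ^ 2 := by
  rw [laplaceMeasure, integral_withDensity_eq_integral_toReal_smul (measurable_laplaceDensity b)
    (.of_forall fun _ => ENNReal.ofReal_lt_top)]
  simp only [toReal_laplaceDensity hb, smul_eq_mul]
  have h1 : ∀ t : ℝ, (2 * b)⁻¹ * Real.exp (-|t| / b) * t ^ 2
      = (fun s : ℝ => (2 * b)⁻¹ * (s ^ ((3 : ℝ) - 1) * Real.exp (-(b⁻¹ * s)))) |t| := fun t => by
    have : (3 : ℝ) - 1 = (2 : ℕ) := by norm_num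
    simp only [this, Real.rpow_natCast, sq_abs]
    rw [show -|t| / b = -(b⁻¹ * |t|) by ring]
    ring
  have hG : Real.Gamma 3 = 2 := by
    rw [show (3 : ℝ) = (2 : ℕ) + 1 by norm_num, Real.Gamma_nat_eq_factorial]
    norm_num
  simp only [h1]
  rw [integral_comp_abs (f := fun s : ℝ => (2 * b)⁻¹ * (s ^ ((3 : ℝ) - 1)
    * Real.exp (-(b⁻¹ * s)))), integral_const_mul,
    Real.integral_rpow_mul_exp_neg_mul_Ioi (by norm_num) (by positivity), hG]
  rw [show (3 : ℝ) = (3 : ℕ) by norm_num, Real.rpow_natCast]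
  field_simp

theorem memLp_two_laplaceMeasure {b : ℝ} (hb : 0 < b) :
    MemLp (fun t : ℝ => t) 2 (laplaceMeasure b) := by
  -- The integral of a non-integrable function is 0 by convention, so the nonzero value `2 * b ^ 2`
  -- proves integrability.
  refine (memLp_two_iff_integrable_sq (by fun_prop)).2 (.of_integral_ne_zero ?_)
  rw [integral_sq_laplaceMeasure hb]
  positivity

theorem integral_id_laplaceMeasure {b : ℝ} (hb : 0 < b) : ∫ t, t ∂laplaceMeasure b = 0 := by
  rw [laplaceMeasure, integral_withDensity_eq_integral_toReal_smul (measurable_laplaceDensity b)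
    (.of_forall fun _ => ENNReal.ofReal_lt_top)]
  simp only [toReal_laplaceDensity hb, smul_eq_mul]
  -- The integrand is odd, so its integral equals its own negative.
  have h := integral_neg_eq_self (fun t : ℝ => (2 * b)⁻¹ * Real.exp (-|t| / b) * t) volume
  simp only [abs_neg, mul_neg, integral_neg] at h
  linarith

variable {n d : ℕ} {Ω : Type*} [MeasurableSpace Ω] {P : Measure Ω} {σ : ℕ → ℝ}
  {ν : ℕ → Fin n → Ω → Vec d}

theorem LaplaceNoise.measurable_coord (hν : LaplaceNoise P σ ν) (k : ℕ) (i : Fin n) (j : Fin d) :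
    Measurable fun ω => ν k i ω j := by
  have := hν.measurable k i
  fun_prop

theorem LaplaceNoise.memLp_coord (hν : LaplaceNoise P σ ν) {k : ℕ} (hσ : 0 < σ k) (i : Fin n)
    (j : Fin d) : MemLp (fun ω => ν k i ω j) 2 P := by
  have h := memLp_two_laplaceMeasure hσ
  rw [← hν.law k i j, memLp_map_measure_iff (by fun_prop)
    (hν.measurable_coord k i j).aemeasurable] at h
  exact h

theorem LaplaceNoise.memLp (hν : LaplaceNoise P σ ν) {k : ℕ} (hσ : 0 < σ k) (i : Fin n) :
    MemLp (ν k i) 2 P :=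
  MemLp.of_eval_piLp fun j => hν.memLp_coord hσ i j

theorem LaplaceNoise.integral_eq_zero (hν : LaplaceNoise P σ ν) [IsFiniteMeasure P] {k : ℕ}
    (hσ : 0 < σ k) (i : Fin n) : ∫ ω, ν k i ω ∂P = 0 := by
  ext j
  rw [eval_integral_piLp fun j => (hν.memLp_coord hσ i j).integrable (by norm_num)]
  have := integral_map (μ := P) (hν.measurable_coord k i j).aemeasurable (f := fun t : ℝ => t)
    (by fun_prop)
  rw [hν.law, integral_id_laplaceMeasure hσ] at this
  exact this.symm

theorem LaplaceNoise.integral_norm_sq (hν : LaplaceNoise P σ ν) {k : ℕ} (hσ : 0 < σ k)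
    (i : Fin n) : ∫ ω, ‖ν k i ω‖ ^ 2 ∂P = d * (2 * σ k ^ 2) := by
  simp only [EuclideanSpace.norm_sq_eq, Real.norm_eq_abs, sq_abs]
  rw [integral_finsetSum _ fun j _ => (hν.memLp_coord hσ i j).integrable_sq]
  have : ∀ j, ∫ ω, ν k i ω j ^ 2 ∂P = 2 * σ k ^ 2 := fun j => by
    have := integral_map (μ := P) (hν.measurable_coord k i j).aemeasurable (f := fun t : ℝ => t ^ 2)
      (by fun_prop)
    rw [hν.law, integral_sq_laplaceMeasure hσ] at this
    exact this.symm
  simp [this]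

end Laplace

/-! ### Independence and orthogonality. -/

/-- If `A` and `B` are independent, and `C` is independent of both together, then `B` is
independent of `A` and `C` together. -/
theorem ProbabilityTheory.IndepFun.prodMk_of_prodMk {Ω R S T : Type*} [MeasurableSpace Ω]
    [MeasurableSpace R] [MeasurableSpace S] [MeasurableSpace T] {P : Measure Ω}
    [IsProbabilityMeasure P] {A : Ω → R} {B : Ω → S} {C : Ω → T} (hA : Measurable A)
    (hB : Measurable B) (hC : Measurable C) (hAB : IndepFun A B P)
    (hABC : IndepFun (fun ω => (A ω, B ω)) C P) : IndepFun (fun ω => (A ω, C ω)) B P := by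
  have hAC : IndepFun A C P := hABC.comp measurable_fst measurable_id
  rw [indepFun_iff_map_prod_eq_prod_map_map (hA.prodMk hC).aemeasurable hB.aemeasurable]
  have := Measure.isProbabilityMeasure_map (μ := P) hA.aemeasurable
  have := Measure.isProbabilityMeasure_map (μ := P) hB.aemeasurable
  have := Measure.isProbabilityMeasure_map (μ := P) hC.aemeasurable
  -- Tested on nonnegative functions, both sides are iterated integrals over the three marginals and
  -- differ only in the order of the last two.
  refine Measure.ext_of_lintegral _ fun f hf => ?_
  rw [lintegral_map hf ((hA.prodMk hC).prodMk hB), lintegral_prod _ hf.aemeasurable,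
    hAC.map_prod_eq_prod_map_map hA.aemeasurable hC.aemeasurable,
    lintegral_prod _ hf.lintegral_prod_right'.aemeasurable]
  have hf' : Measurable fun p : (R × S) × T => f ((p.1.1, p.2), p.1.2) :=
    hf.comp (by fun_prop)
  have h := lintegral_map (μ := P) hf' ((hA.prodMk hB).prodMk hC)
  rw [hABC.map_prod_eq_prod_map_map (hA.prodMk hB).aemeasurable hC.aemeasurable,
    lintegral_prod _ hf'.aemeasurable,
    hAB.map_prod_eq_prod_map_map hA.aemeasurable hB.aemeasurable,
    lintegral_prod _ hf'.lintegral_prod_right'.aemeasurable] at h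
  rw [← h]
  refine lintegral_congr fun a => ?_
  refine lintegral_lintegral_swap (f := fun s t => f ((a, t), s)) ?_
  exact (hf.comp (by fun_prop)).aemeasurable

theorem MeasureTheory.MemLp.integrable_inner_of_two {Ω E : Type*} [MeasurableSpace Ω]
    [NormedAddCommGroup E] [InnerProductSpace ℝ E] {P : Measure Ω} {u w : Ω → E}
    (hu : MemLp u 2 P) (hw : MemLp w 2 P) : Integrable (fun ω => inner ℝ (u ω) (w ω)) P := by
  refine (hu.norm.integrable_mul hw.norm).mono' (hu.1.inner hw.1) (.of_forall fun ω => ?_)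
  exact (Real.norm_eq_abs _).trans_le (abs_real_inner_le_norm _ _)

/-- Pythagoras in `L²`; it splits off first the privacy noise, then the batch error. -/
theorem integral_norm_sub_smul_sq {Ω E : Type*} [MeasurableSpace Ω]
    [NormedAddCommGroup E] [InnerProductSpace ℝ E] {P : Measure Ω} {u w : Ω → E}
    (hu : MemLp u 2 P) (hw : MemLp w 2 P) (huw : ∫ ω, inner ℝ (u ω) (w ω) ∂P = 0) (a : ℝ) :
    ∫ ω, ‖u ω - a • w ω‖ ^ 2 ∂P = ∫ ω, ‖u ω‖ ^ 2 ∂P + a ^ 2 * ∫ ω, ‖w ω‖ ^ 2 ∂P := by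
  have h : ∀ ω, ‖u ω - a • w ω‖ ^ 2
      = ‖u ω‖ ^ 2 - 2 * a * inner ℝ (u ω) (w ω) + a ^ 2 * ‖w ω‖ ^ 2 := fun ω => by
    rw [norm_sub_sq_real, inner_smul_right, norm_smul, mul_pow, Real.norm_eq_abs, sq_abs]
    ring
  have h1 := (memLp_two_iff_integrable_sq_norm hu.1).1 hu
  have h2 := (memLp_two_iff_integrable_sq_norm hw.1).1 hw
  have h3 := (hu.integrable_inner_of_two hw).const_mul (2 * a)
  have h4 : Integrable (fun ω => ‖u ω‖ ^ 2 - 2 * a * inner ℝ (u ω) (w ω)) P := h1.sub h3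
  simp only [h]
  rw [integral_add h4 (h2.const_mul _), integral_sub h1 h3, integral_const_mul,
    integral_const_mul, huw]
  ring

section Fubini

variable {Ω S T E : Type*} [MeasurableSpace Ω] [MeasurableSpace S] [MeasurableSpace T]
  [NormedAddCommGroup E] [MeasurableSpace E] [BorelSpace E] [SecondCountableTopology E]
  {P : Measure Ω} [IsProbabilityMeasure P] {Y : Ω → S} {Z : Ω → T} {F : S → T → E}

/-- A function of independent variables `Y` and `Z` whose second moments with respect to `Z` are
bounded is square integrable. -/
theorem ProbabilityTheory.IndepFun.memLp_two_comp (h : IndepFun Y Z P) (hY : Measurable Y)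
    (hZ : Measurable Z) (hF : Measurable (Function.uncurry F)) {c : ℝ}
    (hF2 : ∀ s, MemLp (F s) 2 (P.map Z)) (hFc : ∀ s, ∫ t, ‖F s t‖ ^ 2 ∂P.map Z ≤ c) :
    MemLp (fun ω => F (Y ω) (Z ω)) 2 P ∧ ∫ ω, ‖F (Y ω) (Z ω)‖ ^ 2 ∂P ≤ c := by
  have := Measure.isProbabilityMeasure_map (μ := P) hY.aemeasurable
  have := Measure.isProbabilityMeasure_map (μ := P) hZ.aemeasurable
  have hmap := h.map_prod_eq_prod_map_map hY.aemeasurable hZ.aemeasurable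
  have hm : StronglyMeasurable fun p : S × T => ‖F p.1 p.2‖ ^ 2 :=
    (hF.norm.pow_const 2).stronglyMeasurable
  have hint : Integrable (fun p : S × T => ‖F p.1 p.2‖ ^ 2) ((P.map Y).prod (P.map Z)) := by
    refine (integrable_prod_iff hm.aestronglyMeasurable).2 ⟨.of_forall fun s =>
      (memLp_two_iff_integrable_sq_norm (hF2 s).1).1 (hF2 s), ?_⟩
    simp only [norm_pow, norm_norm]
    refine Integrable.of_bound hm.integral_prod_right'.aestronglyMeasurable c (.of_forall ?_)
    intro s
    rw [Real.norm_of_nonneg (integral_nonneg fun t => sq_nonneg _)]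
    exact hFc s
  have hint' : Integrable (fun ω => ‖F (Y ω) (Z ω)‖ ^ 2) P := by
    rw [← hmap] at hint
    exact (integrable_map_measure hm.aestronglyMeasurable (hY.prodMk hZ).aemeasurable).1 hint
  refine ⟨(memLp_two_iff_integrable_sq_norm
    (hF.comp (hY.prodMk hZ)).aestronglyMeasurable).2 hint', ?_⟩
  have h1 := integral_map (μ := P) (hY.prodMk hZ).aemeasurable hm.aestronglyMeasurable
  rw [← h1, hmap, integral_prod _ hint]
  calc ∫ s, ∫ t, ‖F s t‖ ^ 2 ∂P.map Z ∂P.map Y ≤ ∫ _, c ∂P.map Y :=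
        integral_mono hint.integral_prod_left (integrable_const c) hFc
    _ = c := by simp

variable [InnerProductSpace ℝ E] [CompleteSpace E]

/-- Noise `F Y Z` whose mean with respect to `Z` vanishes is uncorrelated with functions of
`Y`. -/
theorem ProbabilityTheory.IndepFun.integral_inner_comp_eq_zero (h : IndepFun Y Z P)
    (hY : Measurable Y) (hZ : Measurable Z) (hF : Measurable (Function.uncurry F))
    (hF1 : ∀ s, Integrable (F s) (P.map Z)) (hF0 : ∀ s, ∫ t, F s t ∂P.map Z = 0)
    {φ : S → E} (hφ : Measurable φ)
    (hint : Integrable (fun ω => inner ℝ (φ (Y ω)) (F (Y ω) (Z ω))) P) :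
    ∫ ω, inner ℝ (φ (Y ω)) (F (Y ω) (Z ω)) ∂P = 0 := by
  have := Measure.isProbabilityMeasure_map (μ := P) hY.aemeasurable
  have := Measure.isProbabilityMeasure_map (μ := P) hZ.aemeasurable
  have hmap := h.map_prod_eq_prod_map_map hY.aemeasurable hZ.aemeasurable
  have hm : Measurable fun p : S × T => inner ℝ (φ p.1) (F p.1 p.2) :=
    (hφ.comp measurable_fst).inner hF
  rw [← integral_map (μ := P) (hY.prodMk hZ).aemeasurable
    (f := fun p : S × T => inner ℝ (φ p.1) (F p.1 p.2)) hm.aestronglyMeasurable, hmap,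
    integral_prod]
  · refine integral_eq_zero_of_ae (.of_forall fun s => ?_)
    change ∫ t, inner ℝ (φ s) (F s t) ∂P.map Z = 0
    rw [integral_inner (hF1 s), hF0, inner_zero_right]
  · rw [← hmap]
    exact (integrable_map_measure hm.aestronglyMeasurable (hY.prodMk hZ).aemeasurable).2 hint

end Fubini

/-- The samples of one iteration are independent of those of the earlier ones. -/
theorem SampleProcess.indepFun_truncate {n : ℕ} {Ξ Ω : Type*} [MeasurableSpace Ξ]
    [MeasurableSpace Ω] {P : Measure Ω} {𝒟 : Fin n → Measure Ξ} {ξ : ℕ → Fin n → ℕ → Ω → Ξ}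
    (hξ : SampleProcess P 𝒟 ξ) (s₀ : Fin n → ℕ → Ξ) (K : ℕ) :
    IndepFun (fun ω => truncate s₀ K fun k i l => ξ k i l ω) (fun ω i l => ξ K i l ω) P := by
  have hdisj : Disjoint (Finset.range K) {K} := by simp
  have h := hξ.indep_iterations.indepFun_finset (Finset.range K) {K} hdisj fun k =>
    measurable_pi_lambda _ fun i => measurable_pi_lambda _ fun l => hξ.measurable k i l
  let φ : (Finset.range K → Fin n → ℕ → Ξ) → ℕ → Fin n → ℕ → Ξ := fun u k =>
    if hk : k ∈ Finset.range K then u ⟨k, hk⟩ else s₀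
  have hφ : Measurable φ := by
    refine measurable_pi_lambda _ fun k => ?_
    by_cases hk : k ∈ Finset.range K
    · simpa only [φ, hk, dite_true] using measurable_pi_apply _
    · simp only [φ, hk, dite_false]
      exact measurable_const
  have h' := h.comp hφ (measurable_pi_apply (⟨K, Finset.mem_singleton_self K⟩ : ({K} : Finset ℕ)))
  convert h' using 1
  · funext ω k
    by_cases hk : k < K
    · simp [φ, truncate, hk]
    · simp [φ, truncate, hk]
  · rfl

/-! ### The random run in mean square. -/

section Run

variable {n d : ℕ} {Ξ Ω : Type*} (A : Matrix (Fin n) (Fin n) ℝ) (α β : ℕ → ℝ) (γ : ℕ → ℕ)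
  (g : Fin n → Vec d → Ξ → Vec d) (x₀ : Fin n → Vec d) (ξ : ℕ → Fin n → ℕ → Ω → Ξ)
  (ν : ℕ → Fin n → Ω → Vec d)

/-- The state of the network after `k` iterations with random samples and noises. -/
def runState (k : ℕ) (ω : Ω) : Fin n → Vec d :=
  algState A α β γ g x₀ (fun k _ i l => ξ k i l ω) (fun k i => ν k i ω) k

theorem runState_succ (k : ℕ) (ω : Ω) (i : Fin n) :
    runState A α β γ g x₀ ξ ν (k + 1) ω i
      = (1 - β k) • runState A α β γ g x₀ ξ ν k ω i
        + β k • ∑ j, A i j • runState A α β γ g x₀ ξ ν k ω j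
        - α k • (batchGradient (g i) (γ k) (runState A α β γ g x₀ ξ ν k ω i) (fun l => ξ k i l ω)
          + ν k i ω) := rfl

variable [MeasurableSpace Ξ] [MeasurableSpace Ω] {P : Measure Ω} {𝒟 : Fin n → Measure Ξ}
  {σ : ℕ → ℝ} {A α β γ g x₀ ξ ν}

theorem measurable_algState_samples_noises (hg : ∀ i, Measurable (Function.uncurry (g i)))
    (k : ℕ) : Measurable fun p : (ℕ → Fin n → ℕ → Ξ) × (ℕ → Fin n → Vec d) =>
      algState A α β γ g x₀ (fun k _ => p.1 k) p.2 k :=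
  measurable_algState A α β γ g x₀ hg (fun k i l => (measurable_pi_apply l).comp
    ((measurable_pi_apply i).comp ((measurable_pi_apply k).comp
      (measurable_fst.comp measurable_fst)))) measurable_snd k

theorem SampleProcess.measurable_seq (hξ : SampleProcess P 𝒟 ξ) :
    Measurable fun ω => fun k i l => ξ k i l ω :=
  measurable_pi_lambda _ fun k => measurable_pi_lambda _ fun i => measurable_pi_lambda _ fun l =>
    hξ.measurable k i l

theorem LaplaceNoise.measurable_seq (hν : LaplaceNoise P σ ν) :
    Measurable fun ω => fun k i => ν k i ω :=
  measurable_pi_lambda _ fun k => measurable_pi_lambda _ fun i => hν.measurable k i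

theorem measurable_runState (hg : ∀ i, Measurable (Function.uncurry (g i)))
    (hξ : SampleProcess P 𝒟 ξ) (hν : LaplaceNoise P σ ν) (k : ℕ) :
    Measurable (runState A α β γ g x₀ ξ ν k) :=
  (measurable_algState_samples_noises hg k).comp (hξ.measurable_seq.prodMk hν.measurable_seq)

variable [IsProbabilityMeasure P]

/-- The state is independent of the samples of the coming iteration. -/
theorem indepFun_runState_samples [Nonempty Ξ] (hg : ∀ i, Measurable (Function.uncurry (g i)))
    (hξ : SampleProcess P 𝒟 ξ) (hν : LaplaceNoise P σ ν)
    (hξν : IndepFun (fun ω => fun k i l => ξ k i l ω) (fun ω => fun k i => ν k i ω) P) (k : ℕ) :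
    IndepFun (runState A α β γ g x₀ ξ ν k) (fun ω i l => ξ k i l ω) P := by
  obtain ⟨z₀⟩ := ‹Nonempty Ξ›
  have htr := measurable_truncate (fun (_ : Fin n) (_ : ℕ) => z₀) k
  -- Here `A` is the past samples, `B` the coming ones and `C` all noises; the state is a function
  -- of `A` and `C`.
  have h := IndepFun.prodMk_of_prodMk (htr.comp hξ.measurable_seq)
    ((measurable_pi_apply k).comp hξ.measurable_seq) hν.measurable_seq
    (hξ.indepFun_truncate (fun _ _ => z₀) k)
    (hξν.comp (htr.prodMk (measurable_pi_apply k)) measurable_id)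
  refine (h.comp (measurable_algState_samples_noises (A := A) (α := α) (β := β) (γ := γ)
    (x₀ := x₀) hg k) measurable_id).congr (.of_forall fun ω => ?_) (.of_forall fun ω => rfl)
  exact algState_congr A α β γ g x₀ (fun j hj => funext fun _ =>
    truncate_of_lt (fun _ _ => z₀) (fun k i l => ξ k i l ω) hj)
    fun _ _ => rfl

/-- The noises are independent of the state and the samples of the same iteration. -/
theorem indepFun_runState_noises (hg : ∀ i, Measurable (Function.uncurry (g i)))
    (hξ : SampleProcess P 𝒟 ξ) (hν : LaplaceNoise P σ ν)
    (hξν : IndepFun (fun ω => fun k i l => ξ k i l ω) (fun ω => fun k i => ν k i ω) P) (k : ℕ) :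
    IndepFun (fun ω => (runState A α β γ g x₀ ξ ν k ω, fun i l => ξ k i l ω))
      (fun ω i => ν k i ω) P := by
  have htr := measurable_truncate (0 : Fin n → Vec d) k
  -- The roles are exchanged: `A` is the past noises, `B` the present ones and `C` all samples.
  have h := IndepFun.prodMk_of_prodMk (htr.comp hν.measurable_seq)
    ((measurable_pi_apply k).comp hν.measurable_seq) hξ.measurable_seq
    (hν.indepFun_truncate k) (hξν.symm.comp (htr.prodMk (measurable_pi_apply k)) measurable_id)
  refine (h.comp (((measurable_algState_samples_noises (A := A) (α := α) (β := β) (γ := γ)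
    (x₀ := x₀) hg k).comp measurable_swap).prodMk ((measurable_pi_apply k).comp measurable_snd))
    measurable_id).congr (.of_forall fun ω => ?_) (.of_forall fun ω => rfl)
  refine Prod.ext ?_ rfl
  exact algState_congr A α β γ g x₀ (fun _ _ => rfl) fun j hj =>
    truncate_of_lt 0 (fun k i => ν k i ω) hj

theorem SmoothStronglyConvex.continuous_gradient {f : Vec d → ℝ} {L μ : ℝ}
    (hf : SmoothStronglyConvex f L μ) : Continuous (gradient f) := by
  refine (lipschitzWith_iff_norm_sub_le.2 fun x y => ?_ :
    LipschitzWith L.toNNReal (gradient f)).continuous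
  exact (hf.lipschitz x y).trans
    (mul_le_mul_of_nonneg_right (Real.le_coe_toNNReal L) (norm_nonneg _))

theorem SmoothStronglyConvex.memLp_gradient {f : Vec d → ℝ} {L μ : ℝ}
    (hf : SmoothStronglyConvex f L μ) {X : Ω → Vec d} (hX : MemLp X 2 P) :
    MemLp (fun ω => gradient f (X ω)) 2 P := by
  have h1 : MemLp (fun ω => gradient f (X ω) - gradient f 0) 2 P := by
    refine hX.of_le_mul (c := L) ((hf.continuous_gradient.comp_aestronglyMeasurable hX.1).sub
      aestronglyMeasurable_const) (.of_forall fun ω => ?_)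
    simpa using hf.lipschitz (X ω) 0
  exact (h1.add (memLp_const (gradient f 0))).ae_eq (.of_forall fun ω => by simp)

/-- The error of a batch gradient at the state of the network: it is square integrable with
second moment at most `s ^ 2`, and uncorrelated with functions of the state. -/
theorem batchGradient_error [Nonempty Ξ] {f : Vec d → ℝ} {L μ s : ℝ} {i : Fin n}
    (hf : SmoothStronglyConvex f L μ) (hgi : UnbiasedGradient f (g i) (𝒟 i) s)
    (hξ : SampleProcess P 𝒟 ξ) {X : Ω → Fin n → Vec d} (hX : Measurable X) {k : ℕ}
    (hind : IndepFun X (fun ω i l => ξ k i l ω) P) {N : ℕ} (hN : 0 < N) :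
    MemLp (fun ω => batchGradient (g i) N (X ω i) (fun l => ξ k i l ω) - gradient f (X ω i)) 2 P ∧
    ∫ ω, ‖batchGradient (g i) N (X ω i) (fun l => ξ k i l ω) - gradient f (X ω i)‖ ^ 2 ∂P
      ≤ s ^ 2 ∧
    ∀ φ : (Fin n → Vec d) → Vec d, Measurable φ → MemLp (fun ω => φ (X ω)) 2 P →
      ∫ ω, inner ℝ (φ (X ω)) (batchGradient (g i) N (X ω i) (fun l => ξ k i l ω)
        - gradient f (X ω i)) ∂P = 0 := by
  let F : (Fin n → Vec d) → Ξ → Vec d := fun x z => g i (x i) z - gradient f (x i)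
  have hF : Measurable (Function.uncurry F) := by
    have h1 : Measurable fun p : (Fin n → Vec d) × Ξ => g i (p.1 i) p.2 := by
      have hp : Measurable fun p : (Fin n → Vec d) × Ξ => (p.1 i, p.2) := by fun_prop
      exact hgi.measurable.comp hp
    have h2 : Measurable fun p : (Fin n → Vec d) × Ξ => gradient f (p.1 i) :=
      hf.continuous_gradient.measurable.comp ((measurable_pi_apply i).comp measurable_fst)
    exact h1.sub h2
  have hindl : ∀ l, IndepFun X (ξ k i l) P := fun l =>
    hind.comp measurable_id ((measurable_pi_apply l).comp (measurable_pi_apply i))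
  have hprob : IsProbabilityMeasure (𝒟 i) :=
    hξ.law k i 0 ▸ Measure.isProbabilityMeasure_map (hξ.measurable k i 0).aemeasurable
  have hF2 : ∀ x, MemLp (F x) 2 (𝒟 i) := fun x => (hgi.memLp (x i)).sub (memLp_const _)
  have hF1 : ∀ x, Integrable (F x) (𝒟 i) := fun x => (hF2 x).integrable (by norm_num)
  have hF0 : ∀ x, ∫ z, F x z ∂𝒟 i = 0 := fun x => by
    rw [integral_sub ((hgi.memLp (x i)).integrable (by norm_num)) (integrable_const _),
      hgi.unbiased]
    simp
  have hmom : ∀ l, MemLp (fun ω => F (X ω) (ξ k i l ω)) 2 P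
      ∧ ∫ ω, ‖F (X ω) (ξ k i l ω)‖ ^ 2 ∂P ≤ s ^ 2 := fun l =>
    (hindl l).memLp_two_comp hX (hξ.measurable k i l) hF
      (by rw [hξ.law]; exact hF2) (by rw [hξ.law]; exact fun x => hgi.variance_le (x i))
  have hN' : (N : ℝ) ≠ 0 := Nat.cast_ne_zero.2 hN.ne'
  have hw : ∑ _l ∈ Finset.range N, (N : ℝ)⁻¹ = 1 := by simp [hN']
  have herr : ∀ ω, batchGradient (g i) N (X ω i) (fun l => ξ k i l ω) - gradient f (X ω i)
      = ∑ l ∈ Finset.range N, (N : ℝ)⁻¹ • F (X ω) (ξ k i l ω) := fun ω => by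
    simp only [F, smul_sub, Finset.sum_sub_distrib, ← Finset.sum_smul, hw, one_smul,
      batchGradient, Finset.smul_sum]
  simp only [herr]
  have hsq : ∀ l, Integrable (fun ω => ‖F (X ω) (ξ k i l ω)‖ ^ 2) P := fun l =>
    (memLp_two_iff_integrable_sq_norm (hmom l).1.1).1 (hmom l).1
  have hmem : MemLp (fun ω => ∑ l ∈ Finset.range N, (N : ℝ)⁻¹ • F (X ω) (ξ k i l ω)) 2 P :=
    memLp_finsetSum _ fun l _ => (hmom l).1.const_smul (N : ℝ)⁻¹
  refine ⟨hmem, ?_, fun φ hφ hφX => ?_⟩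
  -- Jensen bounds the error by `s ^ 2` for every batch size. No gain in `N` is needed, since the
  -- factor `α k ^ 2` already makes this term `o (α k)`.
  · calc ∫ ω, ‖∑ l ∈ Finset.range N, (N : ℝ)⁻¹ • F (X ω) (ξ k i l ω)‖ ^ 2 ∂P
        ≤ ∫ ω, ∑ l ∈ Finset.range N, (N : ℝ)⁻¹ * ‖F (X ω) (ξ k i l ω)‖ ^ 2 ∂P := by
          refine integral_mono ((memLp_two_iff_integrable_sq_norm hmem.1).1 hmem)
            (integrable_finsetSum _ fun l _ => (hsq l).const_mul _) fun ω => ?_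
          exact norm_sq_sum_smul_le _ _ _ (fun l _ => by positivity) hw
      _ = ∑ l ∈ Finset.range N, (N : ℝ)⁻¹ * ∫ ω, ‖F (X ω) (ξ k i l ω)‖ ^ 2 ∂P := by
          rw [integral_finsetSum _ fun l _ => (hsq l).const_mul _]
          simp only [integral_const_mul]
      _ ≤ ∑ l ∈ Finset.range N, (N : ℝ)⁻¹ * s ^ 2 :=
          Finset.sum_le_sum fun l _ => mul_le_mul_of_nonneg_left (hmom l).2 (by positivity)
      _ = s ^ 2 := by rw [← Finset.sum_mul, hw, one_mul]
  · simp only [inner_sum, inner_smul_right]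
    have hint : ∀ l, Integrable (fun ω => inner ℝ (φ (X ω)) (F (X ω) (ξ k i l ω))) P := fun l =>
      hφX.integrable_inner_of_two (hmom l).1
    rw [integral_finsetSum _ fun l _ => (hint l).const_mul _]
    refine Finset.sum_eq_zero fun l _ => ?_
    rw [integral_const_mul, (hindl l).integral_inner_comp_eq_zero hX (hξ.measurable k i l) hF
      (by rw [hξ.law]; exact hF1) (by rw [hξ.law]; exact hF0) hφ (hint l), mul_zero]

/-- One iteration in mean square: an exact gradient step, the error of the batch gradient and
the privacy noise. -/
theorem runState_succ_mean_square [Nonempty Ξ] {f : Fin n → Vec d → ℝ} {L : Fin n → ℝ} {μ s : ℝ}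
    (hf : ∀ i, SmoothStronglyConvex (f i) (L i) μ)
    (hg : ∀ i, UnbiasedGradient (f i) (g i) (𝒟 i) s)
    (hξ : SampleProcess P 𝒟 ξ) (hν : LaplaceNoise P σ ν)
    (hξν : IndepFun (fun ω => fun k i l => ξ k i l ω) (fun ω => fun k i => ν k i ω) P) {k : ℕ}
    (hσ : 0 < σ k) (hγ : 0 < γ k)
    (hX : ∀ i, MemLp (fun ω => runState A α β γ g x₀ ξ ν k ω i) 2 P) (p : Vec d) (i : Fin n) :
    MemLp (fun ω => runState A α β γ g x₀ ξ ν (k + 1) ω i) 2 P ∧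
    MemLp (fun ω => (1 - β k) • runState A α β γ g x₀ ξ ν k ω i
      + β k • ∑ j, A i j • runState A α β γ g x₀ ξ ν k ω j
      - α k • gradient (f i) (runState A α β γ g x₀ ξ ν k ω i) - p) 2 P ∧
    ∫ ω, ‖runState A α β γ g x₀ ξ ν (k + 1) ω i - p‖ ^ 2 ∂P
      ≤ ∫ ω, ‖(1 - β k) • runState A α β γ g x₀ ξ ν k ω i
          + β k • ∑ j, A i j • runState A α β γ g x₀ ξ ν k ω j
          - α k • gradient (f i) (runState A α β γ g x₀ ξ ν k ω i) - p‖ ^ 2 ∂P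
        + α k ^ 2 * (s ^ 2 + d * (2 * σ k ^ 2)) := by
  set X := runState A α β γ g x₀ ξ ν k with hXdef
  have hgm : ∀ i, Measurable (Function.uncurry (g i)) := fun i => (hg i).measurable
  have hXm : Measurable X := measurable_runState hgm hξ hν k
  obtain ⟨hδ, hδs, hδ0⟩ := batchGradient_error (hf i) (hg i) hξ hXm
    (indepFun_runState_samples hgm hξ hν hξν k) hγ
  let φ : (Fin n → Vec d) → Vec d := fun x => (1 - β k) • x i + β k • ∑ j, A i j • x j
    - α k • gradient (f i) (x i) - p
  have hφ : Measurable φ := by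
    have h1 : Measurable fun x : Fin n → Vec d => gradient (f i) (x i) :=
      (hf i).continuous_gradient.measurable.comp (measurable_pi_apply i)
    have h2 : Measurable fun x : Fin n → Vec d => (1 - β k) • x i + β k • ∑ j, A i j • x j := by
      fun_prop
    exact (h2.sub (h1.const_smul (α k))).sub_const p
  have hφX : MemLp (fun ω => φ (X ω)) 2 P := by
    have h1 : MemLp (fun ω => ∑ j, A i j • X ω j) 2 P :=
      memLp_finsetSum _ fun j _ => (hX j).const_smul (A i j)
    exact ((((hX i).const_smul (1 - β k)).add (h1.const_smul (β k))).sub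
      (((hf i).memLp_gradient (hX i)).const_smul (α k))).sub (memLp_const p)
  let δ : (Fin n → Vec d) × (Fin n → ℕ → Ξ) → Vec d := fun q =>
    batchGradient (g i) (γ k) (q.1 i) (q.2 i) - gradient (f i) (q.1 i)
  have hδm : Measurable δ := by
    have h1 : Measurable fun q : (Fin n → Vec d) × (Fin n → ℕ → Ξ) =>
        batchGradient (g i) (γ k) (q.1 i) (q.2 i) := by
      refine Measurable.fun_const_smul (Finset.measurable_sum _ fun l _ => ?_) _
      have hq : Measurable fun q : (Fin n → Vec d) × (Fin n → ℕ → Ξ) => (q.1 i, q.2 i l) := by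
        fun_prop
      exact (hgm i).comp hq
    have h2 : Measurable fun q : (Fin n → Vec d) × (Fin n → ℕ → Ξ) => gradient (f i) (q.1 i) :=
      (hf i).continuous_gradient.measurable.comp ((measurable_pi_apply i).comp measurable_fst)
    exact h1.sub h2
  let Q : Ω → (Fin n → Vec d) × (Fin n → ℕ → Ξ) := fun ω => (X ω, fun i l => ξ k i l ω)
  have hQ : Measurable Q := hXm.prodMk (measurable_pi_lambda _ fun i =>
    measurable_pi_lambda _ fun l => hξ.measurable k i l)
  have hind : IndepFun Q (ν k i) P :=
    (indepFun_runState_noises hgm hξ hν hξν k).comp measurable_id (measurable_pi_apply i)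
  have hνL : MemLp (ν k i) 2 P := hν.memLp hσ i
  -- The batch error is uncorrelated with functions of the state only, whereas the noise is also
  -- independent of the samples; so the noise is peeled off first, from the exact step and batch
  -- error together.
  let ψ : (Fin n → Vec d) × (Fin n → ℕ → Ξ) → Vec d := fun q => φ q.1 - α k • δ q
  have hψ : Measurable ψ := (hφ.comp measurable_fst).sub (hδm.const_smul (α k))
  have hψQ : MemLp (fun ω => ψ (Q ω)) 2 P := hφX.sub (hδ.const_smul (α k))
  have hν0 : ∫ ω, inner ℝ (ψ (Q ω)) (ν k i ω) ∂P = 0 := by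
    refine hind.integral_inner_comp_eq_zero (F := fun _ t => t) hQ (hν.measurable k i)
      measurable_snd (fun _ => ?_) (fun _ => ?_) hψ (hψQ.integrable_inner_of_two hνL)
    · exact (integrable_map_measure aestronglyMeasurable_id
        (hν.measurable k i).aemeasurable).2 (hνL.integrable (by norm_num))
    · rw [integral_map (hν.measurable k i).aemeasurable (f := fun t : Vec d => t)
        aestronglyMeasurable_id]
      exact hν.integral_eq_zero hσ i
  have hsucc : ∀ ω, runState A α β γ g x₀ ξ ν (k + 1) ω i - p = ψ (Q ω) - α k • ν k i ω :=
    fun ω => by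
      rw [runState_succ, ← hXdef]
      simp only [ψ, φ, δ, Q]
      module
  refine ⟨?_, hφX, ?_⟩
  · have h := (hψQ.sub (hνL.const_smul (α k))).add (memLp_const p)
    refine h.ae_eq (.of_forall fun ω => ?_)
    change ψ (Q ω) - α k • ν k i ω + p = _
    rw [← hsucc, sub_add_cancel]
  · simp only [hsucc]
    rw [integral_norm_sub_smul_sq hψQ hνL hν0,
      integral_norm_sub_smul_sq hφX hδ (hδ0 φ hφ hφX), hν.integral_norm_sq hσ]
    have := mul_le_mul_of_nonneg_left hδs (sq_nonneg (α k))
    linarith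

theorem memLp_runState [Nonempty Ξ] {f : Fin n → Vec d → ℝ} {L : Fin n → ℝ} {μ s : ℝ}
    (hf : ∀ i, SmoothStronglyConvex (f i) (L i) μ)
    (hg : ∀ i, UnbiasedGradient (f i) (g i) (𝒟 i) s)
    (hξ : SampleProcess P 𝒟 ξ) (hν : LaplaceNoise P σ ν)
    (hξν : IndepFun (fun ω => fun k i l => ξ k i l ω) (fun ω => fun k i => ν k i ω) P)
    (hσ : ∀ k, 0 < σ k) (hγ : ∀ k, 0 < γ k) :
    ∀ k i, MemLp (fun ω => runState A α β γ g x₀ ξ ν k ω i) 2 P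
  | 0, i => memLp_const (x₀ i)
  | k + 1, i => (runState_succ_mean_square hf hg hξ hν hξν (hσ k) (hγ k)
      (memLp_runState hf hg hξ hν hξν hσ hγ k) 0 i).1

/-- Mean-square convergence, for step sizes `α` and `β` with `∑ α = ∞`, `α / β → 0`, `β → 0` and
`α σ ^ 2 → 0`. -/
theorem tendsto_mean_square_runState [Nonempty Ξ] {G : SimpleGraph (Fin n)}
    (hA : NetworkWeights G A) {f : Fin n → Vec d → ℝ} {L : Fin n → ℝ} {μ s : ℝ} (hμ : 0 < μ)
    (hf : ∀ i, SmoothStronglyConvex (f i) (L i) μ)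
    (hg : ∀ i, UnbiasedGradient (f i) (g i) (𝒟 i) s)
    (hξ : SampleProcess P 𝒟 ξ) (hν : LaplaceNoise P σ ν)
    (hξν : IndepFun (fun ω => fun k i l => ξ k i l ω) (fun ω => fun k i => ν k i ω) P)
    (hσ : ∀ k, 0 < σ k) (hγ : ∀ k, 0 < γ k) (hα : ∀ k, 0 < α k) (hβ : ∀ k, 0 < β k)
    (hαsum : ¬ Summable α) (hα0 : Tendsto α atTop (𝓝 0)) (hβ0 : Tendsto β atTop (𝓝 0))
    (hαβ : Tendsto (fun k => α k / β k) atTop (𝓝 0))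
    (hασ : Tendsto (fun k => α k * σ k ^ 2) atTop (𝓝 0))
    {p : Vec d} (hp : ∑ i, gradient (f i) p = 0) (i : Fin n) :
    Tendsto (fun k => ∫ ω, ‖runState A α β γ g x₀ ξ ν k ω i - p‖ ^ 2 ∂P) atTop (𝓝 0) := by
  have hmem := memLp_runState (A := A) (α := α) (β := β) (x₀ := x₀) hf hg hξ hν hξν hσ hγ
  obtain ⟨C, a₀, hC, ha₀, hstep⟩ := hA.exists_sum_norm_step_sq_le hμ (fun i => (hf i).lipschitz)
    (fun i => (hf i).stronglyConvex) hp
  have hsq : ∀ {u : Ω → Vec d}, MemLp u 2 P → Integrable (fun ω => ‖u ω‖ ^ 2) P := fun hu =>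
    (memLp_two_iff_integrable_sq_norm hu.1).1 hu
  have hint : ∀ k i, Integrable (fun ω => ‖runState A α β γ g x₀ ξ ν k ω i - p‖ ^ 2) P :=
    fun k i => hsq ((hmem k i).sub (memLp_const p))
  -- The exact step contracts only the sum over the agents. The recursion has `u = α * μ`, and `r`
  -- collects the perturbations divided by `α * μ`.
  let V : ℕ → ℝ := fun k => ∑ i, ∫ ω, ‖runState A α β γ g x₀ ξ ν k ω i - p‖ ^ 2 ∂P
  have hV : Tendsto V atTop (𝓝 0) := by
    refine tendsto_zero_of_le_one_sub_mul_add (u := fun k => α k * μ)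
      (r := fun k => (C * (α k / β k) + n * (α k * s ^ 2 + d * (2 * (α k * σ k ^ 2)))) / μ)
      (fun k => Finset.sum_nonneg fun i _ => integral_nonneg fun ω => sq_nonneg _)
      (fun k => (mul_pos (hα k) hμ).le) ?_ ?_ ?_ ?_
    · have : Tendsto (fun k => α k * μ) atTop (𝓝 0) := by simpa using hα0.mul_const μ
      exact (this.eventually_lt_const one_pos).mono fun k hk => hk.le
    · rwa [summable_mul_right_iff hμ.ne']
    · have := ((hαβ.const_mul C).add (((hα0.mul_const (s ^ 2)).add
        ((hασ.const_mul 2).const_mul (d : ℝ))).const_mul (n : ℝ))).div_const μ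
      simpa using this
    · filter_upwards [hα0.eventually_lt_const ha₀,
        hβ0.eventually_lt_const (show (0 : ℝ) < 1 / 4 by norm_num)] with k hαk hβk
      have hone := fun i => runState_succ_mean_square hf hg hξ hν hξν (hσ k) (hγ k) (hmem k) p i
      have hexact := integral_mono
        (integrable_finsetSum Finset.univ fun i _ => hsq (hone i).2.1)
        (((integrable_finsetSum Finset.univ fun i _ => hint k i).const_mul
          (1 - α k * μ)).add (integrable_const (C * (α k ^ 2 / β k))))
        fun ω => hstep (α k) (β k) (hα k) hαk.le (hβ k) hβk.le (runState A α β γ g x₀ ξ ν k ω)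
      simp only [Pi.add_apply] at hexact
      rw [integral_finsetSum _ fun i _ => hsq (hone i).2.1,
        integral_add ((integrable_finsetSum Finset.univ fun i _ => hint k i).const_mul _)
          (integrable_const _), integral_const_mul,
        integral_finsetSum _ fun i _ => hint k i] at hexact
      simp only [integral_const, probReal_univ, one_smul] at hexact
      have hsum := Finset.sum_le_sum fun i (_ : i ∈ Finset.univ) => (hone i).2.2
      rw [Finset.sum_add_distrib, Finset.sum_const, Finset.card_univ, Fintype.card_fin,
        nsmul_eq_mul] at hsum
      refine (hsum.trans (add_le_add_left hexact _)).trans_eq ?_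
      have hα' := (hα k).ne'
      have hβ' := (hβ k).ne'
      have hμ' := hμ.ne'
      simp only [V]
      field_simp
      ring
  refine squeeze_zero (fun k => integral_nonneg fun ω => sq_nonneg _) (fun k => ?_) hV
  exact Finset.single_le_sum
    (f := fun i => ∫ ω, ‖runState A α β γ g x₀ ξ ν k ω i - p‖ ^ 2 ∂P)
    (fun i _ => integral_nonneg fun ω => sq_nonneg _) (Finset.mem_univ i)

end Run

/-! ### Power sequences and the conclusion. -/

theorem tendsto_natCast_add_rpow_zero (a₂ : ℝ) {s : ℝ} (hs : s < 0) :
    Tendsto (fun k : ℕ => ((k : ℝ) + a₂) ^ s) atTop (𝓝 0) := by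
  have h := tendsto_rpow_neg_atTop (neg_pos.2 hs)
  rw [neg_neg] at h
  exact h.comp (tendsto_atTop_add_const_right _ a₂ tendsto_natCast_atTop_atTop)

theorem summable_one_div_natCast_add_rpow_iff {a₂ : ℝ} (ha₂ : 0 < a₂) {s : ℝ} :
    (Summable fun k : ℕ => 1 / ((k : ℝ) + a₂) ^ s) ↔ 1 < s := by
  rw [← Real.summable_one_div_nat_add_rpow a₂ s]
  refine summable_congr fun k => ?_
  rw [abs_of_pos (by positivity)]

end

theorem corollary2 {n d : ℕ} {Ξ Ω : Type*} [MeasurableSpace Ξ] [MeasurableSpace Ω]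
    -- the optimization problem
    (𝒟 : Fin n → Measure Ξ) [∀ i, IsProbabilityMeasure (𝒟 i)]
    (ℓ : Fin n → Vec d → Ξ → ℝ) (hℓ : ∀ i x, Integrable (ℓ i x) (𝒟 i))
    (L : Fin n → ℝ) (hL : ∀ i, 0 < L i) (μ : ℝ) (hμ : 0 < μ)
    (hf : ∀ i, SmoothStronglyConvex (expectedCost (ℓ i) (𝒟 i)) (L i) μ)
    -- the stochastic gradients
    (g : Fin n → Vec d → Ξ → Vec d) (σg : ℝ) (hσg : 0 < σg)
    (hg : ∀ i, UnbiasedGradient (expectedCost (ℓ i) (𝒟 i)) (g i) (𝒟 i) σg)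
    -- the network
    (G : SimpleGraph (Fin n)) (A : Matrix (Fin n) (Fin n) ℝ) (hA : NetworkWeights G A)
    -- the parameters
    (a₁ a₂ a₃ b α β γ η : ℝ) (ha₁ : 0 < a₁) (ha₂ : 0 < a₂) (ha₃ : 0 < a₃) (hb : 0 < b)
    (hγη : 1 < γ + η) (hβ : 0 < β) (hβα : β < α) (hα : α ≤ 1) (hγ : 0 ≤ γ) (hη : 0 ≤ η)
    (hη' : η ≤ min (β / 2) ((α - β) / 2))
    (αs βs σs : ℕ → ℝ) (γs : ℕ → ℕ)
    (hαs : ∀ k : ℕ, αs k = a₁ / ((k : ℝ) + a₂) ^ α)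
    (hβs : ∀ k : ℕ, βs k = a₁ / ((k : ℝ) + a₂) ^ β)
    (hγs : ∀ k : ℕ, γs k = ⌈a₃ * ((k : ℝ) + a₂) ^ γ⌉₊)
    (hσs : ∀ k : ℕ, σs k = b * ((k : ℝ) + a₂) ^ η)
    -- the initial values and the randomness
    (x₀ : Fin n → Vec d)
    (P : Measure Ω) [IsProbabilityMeasure P]
    (ξ : ℕ → Fin n → ℕ → Ω → Ξ) (hξ : SampleProcess P 𝒟 ξ)
    (ν : ℕ → Fin n → Ω → Vec d) (hν : LaplaceNoise P σs ν)
    (hξν : IndepFun (fun ω => fun k i l => ξ k i l ω) (fun ω => fun k i => ν k i ω) P) :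
    -- mean-square convergence of all agents to an optimal solution
    (∃ xopt : Vec d,
      (∀ x, ∑ i, expectedCost (ℓ i) (𝒟 i) xopt ≤ ∑ i, expectedCost (ℓ i) (𝒟 i) x) ∧
      ∀ i,
        (∀ k, MemLp (fun ω => algState A αs βs γs g x₀ (fun k _ i l => ξ k i l ω)
          (fun k i => ν k i ω) k i) 2 P) ∧
        Tendsto (fun k => ∫ ω, ‖algState A αs βs γs g x₀ (fun k _ i l => ξ k i l ω)
          (fun k i => ν k i ω) k i - xopt‖ ^ 2 ∂P) atTop (𝓝 0)) ∧
    -- differential privacy, with a finite cumulative budget for the infinite run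
    (∀ C : ℝ, 0 < C →
      Summable (fun k => C / (γs k * σs k)) ∧
      (∀ (k : ℕ) (x : Fin n → Vec d),
        DifferentiallyPrivate P (AdjacentSamples g C (γs k) x)
          (fun z ω => noisyGradients g (γs k) x z (fun i => ν k i ω)) (C / (γs k * σs k))) ∧
      DifferentiallyPrivate P (AdjacentStreams g C γs)
        (fun (D : DataStream n d Ξ) ω =>
          algTranscript A αs βs γs g x₀ D.z (fun k i => ν k i ω))
        (∑' k, C / (γs k * σs k))) := by
  obtain ⟨i₀⟩ := hA.connected.nonempty
  -- A connected network has a node, which gives both `n ≠ 0` and, through the law of its samples, a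
  -- point of `Ξ`.
  have : NeZero n := ⟨fun h => by subst h; exact i₀.elim0⟩
  have : Nonempty Ξ := nonempty_of_isProbabilityMeasure (𝒟 i₀)
  have ht : ∀ k : ℕ, 0 < (k : ℝ) + a₂ := fun k => by positivity
  have hα0 : 0 < α := hβ.trans hβα
  -- The exponent of `αs k * σs k ^ 2`: the noise may grow, but `2 * η ≤ α - β < α`.
  have hηα : 2 * η - α < 0 := by
    have := hη'.trans (min_le_right _ _)
    linarith
  have hαpos : ∀ k, 0 < αs k := fun k => by
    rw [hαs]
    exact div_pos ha₁ (Real.rpow_pos_of_pos (ht k) _)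
  have hβpos : ∀ k, 0 < βs k := fun k => by
    rw [hβs]
    exact div_pos ha₁ (Real.rpow_pos_of_pos (ht k) _)
  have hσpos : ∀ k, 0 < σs k := fun k => by
    rw [hσs]
    exact mul_pos hb (Real.rpow_pos_of_pos (ht k) _)
  have hγpos : ∀ k, 0 < γs k := fun k => by
    rw [hγs]
    exact Nat.ceil_pos.2 (mul_pos ha₃ (Real.rpow_pos_of_pos (ht k) _))
  have hlim : ∀ {s : ℝ}, 0 < s →
      Tendsto (fun k : ℕ => a₁ / ((k : ℝ) + a₂) ^ s) atTop (𝓝 0) := fun {s} hs => by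
    have h := (tendsto_natCast_add_rpow_zero a₂ (neg_lt_zero.2 hs)).const_mul a₁
    rw [mul_zero] at h
    refine h.congr fun k => ?_
    rw [Real.rpow_neg (ht k).le, div_eq_mul_inv]
  refine ⟨?_, fun C hC => ?_⟩
  · obtain ⟨p, hp, hmin⟩ := exists_minimizer hμ hf
    refine ⟨p, hmin, fun i => ⟨fun k => ?_, ?_⟩⟩
    · exact memLp_runState hf hg hξ hν hξν hσpos hγpos k i
    · refine tendsto_mean_square_runState hA hμ hf hg hξ hν hξν hσpos hγpos hαpos hβpos
        ?_ ?_ ?_ ?_ ?_ hp i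
      · have h : αs = fun k : ℕ => a₁ * (1 / ((k : ℝ) + a₂) ^ α) := funext fun k => by
          rw [hαs, mul_one_div]
        rw [h, summable_mul_left_iff ha₁.ne', summable_one_div_natCast_add_rpow_iff ha₂]
        exact not_lt.2 hα
      · exact (hlim hα0).congr fun k => (hαs k).symm
      · exact (hlim hβ).congr fun k => (hβs k).symm
      · refine (tendsto_natCast_add_rpow_zero a₂ (sub_neg.2 hβα)).congr fun k => ?_
        have h1 := (Real.rpow_pos_of_pos (ht k) α).ne'
        have h2 := (Real.rpow_pos_of_pos (ht k) β).ne'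
        rw [hαs, hβs, Real.rpow_sub (ht k)]
        field_simp
      · have h := (tendsto_natCast_add_rpow_zero a₂ hηα).const_mul (a₁ * b ^ 2)
        rw [mul_zero] at h
        refine h.congr fun k => ?_
        rw [hαs, hσs, mul_pow, ← Real.rpow_mul_natCast (ht k).le, Real.rpow_sub (ht k),
          mul_comm 2 η]
        push_cast
        ring
  -- The ceiling only increases `γs k`, so each term is at most a constant times the power of
  -- exponent `-(γ + η)`.
  · have hsum : Summable fun k => C / (γs k * σs k) := by
      refine Summable.of_nonneg_of_le (fun k => ?_) (fun k => ?_)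
        (((summable_one_div_natCast_add_rpow_iff ha₂).2 hγη).mul_left (C / (a₃ * b)))
      · exact div_nonneg hC.le (mul_nonneg (Nat.cast_nonneg _) (hσpos k).le)
      · have hγk : a₃ * ((k : ℝ) + a₂) ^ γ ≤ γs k := by
          rw [hγs]
          exact Nat.le_ceil _
        have h1 := Real.rpow_pos_of_pos (ht k) γ
        have h2 := Real.rpow_pos_of_pos (ht k) η
        calc C / (γs k * σs k)
            ≤ C / (a₃ * ((k : ℝ) + a₂) ^ γ * (b * ((k : ℝ) + a₂) ^ η)) := by
              rw [hσs]
              gcongr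
          _ = C / (a₃ * b) * (1 / ((k : ℝ) + a₂) ^ (γ + η)) := by
              rw [Real.rpow_add (ht k)]
              field_simp
    exact ⟨hsum, fun k x => hν.differentiallyPrivate_noisyGradients (hσpos k) g C _ x,
      hν.differentiallyPrivate_algTranscript A αs βs γs g x₀ hσpos (fun i => (hg i).measurable)
        hC.le hsum⟩
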